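/- Let $K$ be a field of characteristic different from $2$. A bicommutative superalgebra over $K$ is a (not necessarily associative or unital) $K$-algebra $A=A_0\oplus A_1$ with $A_iA_j\subseteq A_{i+j \,(\mathrm{mod}\ 2)}$ such that $$x_1(x_2x_3)=(-1)^{\overline{x_1}\,\overline{x_2}}x_2(x_1x_3),\qquad (x_1x_2)x_3=(-1)^{\overline{x_2}\,\overline{x_3}}(x_1x_3)x_2$$ for all homogeneous $x_1,x_2,x_3\in A$, where $\overline{x}\in\{0,1\}$ is the parity of $x$. For integers $p,q\ge 0$ let $F_{p,q}=F_{p,q}(\mathfrak B_{\rm sup})$ be the free bicommutative superalgebra with even free generators $y_1,\dots,y_p$ and odd free generators $z_1,\dots,z_q$. For ${\bf k}\in\mathbb N_0^p$ and ${\bf l}\in\mathbb N_0^q$ let $F_{p,q}^{({\bf k},{\bf l})}$ be the span of the monomials of degree $k_i$ in $y_i$ and $l_j$ in $z_j$ for all $i,j$; let $F_{p,q}^{(k,l)}$ be the span of the monomials of total degree $k$ in the even and $l$ in the odd generators; and let $F_{p,q}^{(n)}$ be the span of the monomials of total degree $n$. Define the Hilbert series (formal power series) $$H(F_{p,q},U_p,V_q)=\sum_{{\bf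 k},{\bf l}}\dim_K\big(F_{p,q}^{({\bf k},{\bf l})}\big)\,u_1^{k_1}\cdots u_p^{k_p}v_1^{l_1}\cdots v_q^{l_q},$$ $$H(F_{p,q},u,v)=\sum_{k,l}\dim_K\big(F_{p,q}^{(k,l)}\big)u^kv^l,\qquad H(F_{p,q},t)=\sum_{n}\dim_K\big(F_{p,q}^{(n)}\big)t^n .$$ Then $$H(F_{p,q},U_p,V_q)=\sum_{i=1}^pu_i+\sum_{j=1}^qv_j+\left(\prod_{i=1}^p\frac{1}{1-u_i}\prod_{j=1}^q(1+v_j)-1\right)^2,$$ $$H(F_{p,q},u,v)=pu+qv+\left(\frac{(1+v)^q}{(1-u)^p}-1\right)^2,$$ $$H(F_{p,q},t)=(p+q)t+\left(\frac{(1+t)^q}{(1-t)^p}-1\right)^2 .$$ -/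

import Mathlib

noncomputable section

namespace BicommSuper

/-! ### Bicommutative superalgebras -/

/-- The sign `(-1)^{ij}` for parities `i, j`. -/
def sgn (K : Type*) [Field K] (i j : ZMod 2) : K := (-1) ^ (i.val * j.val)

/-- The (not necessarily unital or associative) `K`-algebra `A` with even component `𝒜 0` and odd
component `𝒜 1` is a bicommutative superalgebra. -/
structure IsBicommutativeSuperalgebra (K : Type*) [Field K] {A : Type*} [NonUnitalNonAssocRing A]
    [Module K A] (𝒜 : ZMod 2 → Submodule K A) : Prop where
  isInternal : DirectSum.IsInternal 𝒜
  mul_mem : ∀ {i j : ZMod 2} {x y : A}, x ∈ 𝒜 i → y ∈ 𝒜 j → x * y ∈ 𝒜 (i + j)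
  left_comm : ∀ {i j k : ZMod 2} {x y z : A}, x ∈ 𝒜 i → y ∈ 𝒜 j → z ∈ 𝒜 k →
    x * (y * z) = sgn K i j • (y * (x * z))
  right_comm : ∀ {i j k : ZMod 2} {x y z : A}, x ∈ 𝒜 i → y ∈ 𝒜 j → z ∈ 𝒜 k →
    (x * y) * z = sgn K j k • ((x * z) * y)

/-! ### Degrees of nonassociative monomials -/

/-- The total weight of a nonassociative monomial when each letter `x` has weight `w x`. -/
def wt {X M : Type*} [Add M] (w : X → M) : FreeMagma X → M
  | .of x => w x
  | .mul s t => wt w s + wt w t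

/-- Even generators `Y` have parity `0`, odd generators `Z` have parity `1`. -/
def parityWeight (Y Z : Type*) : Y ⊕ Z → ZMod 2 := Sum.elim (fun _ => 0) (fun _ => 1)

/-- The span of all monomials of weight `m` in the free nonassociative algebra. -/
def absComponent (K : Type*) [Field K] {X M : Type*} [Add M] (w : X → M) (m : M) :
    Submodule K (FreeNonUnitalNonAssocAlgebra K X) :=
  Submodule.span K ((fun t => MonoidAlgebra.single t (1 : K)) '' {t | wt w t = m})

/-! ### The free bicommutative superalgebra -/

/-- The differences of the two sides of the two super-identities, for all homogeneous elements of
the free nonassociative superalgebra on `Y ⊕ Z`. -/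
inductive IsRelator (K : Type*) [Field K] (Y Z : Type*) :
    FreeNonUnitalNonAssocAlgebra K (Y ⊕ Z) → Prop
  | left {i j k : ZMod 2} {x y z : FreeNonUnitalNonAssocAlgebra K (Y ⊕ Z)}
      (hx : x ∈ absComponent K (parityWeight Y Z) i)
      (hy : y ∈ absComponent K (parityWeight Y Z) j)
      (hz : z ∈ absComponent K (parityWeight Y Z) k) :
      IsRelator K Y Z (x * (y * z) - sgn K i j • (y * (x * z)))
  | right {i j k : ZMod 2} {x y z : FreeNonUnitalNonAssocAlgebra K (Y ⊕ Z)}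
      (hx : x ∈ absComponent K (parityWeight Y Z) i)
      (hy : y ∈ absComponent K (parityWeight Y Z) j)
      (hz : z ∈ absComponent K (parityWeight Y Z) k) :
      IsRelator K Y Z ((x * y) * z - sgn K j k • ((x * z) * y))

/-- The two-sided ideal generated by the relators: the smallest subspace that contains them and is
stable under left and right multiplication. -/
def relIdeal (K : Type*) [Field K] (Y Z : Type*) :
    Submodule K (FreeNonUnitalNonAssocAlgebra K (Y ⊕ Z)) :=
  sInf {J | (∀ r, IsRelator K Y Z r → r ∈ J) ∧ ∀ a ∈ J, ∀ b, b * a ∈ J ∧ a * b ∈ J}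

theorem relator_mem {K : Type*} [Field K] {Y Z : Type*}
    {r : FreeNonUnitalNonAssocAlgebra K (Y ⊕ Z)} (h : IsRelator K Y Z r) : r ∈ relIdeal K Y Z := by
  rw [relIdeal, Submodule.mem_sInf]
  exact fun J hJ => hJ.1 r h

theorem mul_left_mem {K : Type*} [Field K] {Y Z : Type*}
    {a : FreeNonUnitalNonAssocAlgebra K (Y ⊕ Z)} (h : a ∈ relIdeal K Y Z)
    (b : FreeNonUnitalNonAssocAlgebra K (Y ⊕ Z)) : b * a ∈ relIdeal K Y Z := by
  rw [relIdeal, Submodule.mem_sInf] at *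
  exact fun J hJ => (hJ.2 a (h J hJ) b).1

theorem mul_right_mem {K : Type*} [Field K] {Y Z : Type*}
    {a : FreeNonUnitalNonAssocAlgebra K (Y ⊕ Z)} (h : a ∈ relIdeal K Y Z)
    (b : FreeNonUnitalNonAssocAlgebra K (Y ⊕ Z)) : a * b ∈ relIdeal K Y Z := by
  rw [relIdeal, Submodule.mem_sInf] at *
  exact fun J hJ => (hJ.2 a (h J hJ) b).2

/-- The free bicommutative superalgebra on the even generators `Y` and the odd generators `Z`. -/
def Free (K : Type*) [Field K] (Y Z : Type*) : Type _ :=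
  FreeNonUnitalNonAssocAlgebra K (Y ⊕ Z) ⧸ relIdeal K Y Z

instance instAddCommGroupFree (K : Type*) [Field K] (Y Z : Type*) : AddCommGroup (Free K Y Z) :=
  inferInstanceAs (AddCommGroup (FreeNonUnitalNonAssocAlgebra K (Y ⊕ Z) ⧸ relIdeal K Y Z))

instance instModuleFree (K : Type*) [Field K] (Y Z : Type*) : Module K (Free K Y Z) :=
  inferInstanceAs (Module K (FreeNonUnitalNonAssocAlgebra K (Y ⊕ Z) ⧸ relIdeal K Y Z))

/-- The quotient map. -/
def mk (K : Type*) [Field K] (Y Z : Type*) :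
    FreeNonUnitalNonAssocAlgebra K (Y ⊕ Z) →ₗ[K] Free K Y Z :=
  (relIdeal K Y Z).mkQ

theorem mk_surjective (K : Type*) [Field K] (Y Z : Type*) : Function.Surjective (mk K Y Z) :=
  Submodule.mkQ_surjective _

theorem mk_eq_iff {K : Type*} [Field K] {Y Z : Type*}
    {a b : FreeNonUnitalNonAssocAlgebra K (Y ⊕ Z)} :
    mk K Y Z a = mk K Y Z b ↔ a - b ∈ relIdeal K Y Z :=
  Submodule.Quotient.eq _

instance instMulFree (K : Type*) [Field K] (Y Z : Type*) : Mul (Free K Y Z) :=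
  ⟨Quotient.map₂ (· * ·) (by
    intro a a' ha b b' hb
    have ha' : a - a' ∈ relIdeal K Y Z := (Submodule.quotientRel_def _).1 ha
    have hb' : b - b' ∈ relIdeal K Y Z := (Submodule.quotientRel_def _).1 hb
    refine (Submodule.quotientRel_def _).2 ?_
    have h : a * b - a' * b' = (a - a') * b + a' * (b - b') := by
      rw [sub_mul, mul_sub]; abel
    rw [h]
    exact add_mem (mul_right_mem ha' b) (mul_left_mem hb' a'))⟩

theorem mk_mul (K : Type*) [Field K] (Y Z : Type*)
    (a b : FreeNonUnitalNonAssocAlgebra K (Y ⊕ Z)) :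
    mk K Y Z (a * b) = mk K Y Z a * mk K Y Z b := rfl

instance instRingFree (K : Type*) [Field K] (Y Z : Type*) : NonUnitalNonAssocRing (Free K Y Z) :=
  { instAddCommGroupFree K Y Z, instMulFree K Y Z with
    left_distrib := by
      intro a b c
      obtain ⟨a, rfl⟩ := mk_surjective K Y Z a
      obtain ⟨b, rfl⟩ := mk_surjective K Y Z b
      obtain ⟨c, rfl⟩ := mk_surjective K Y Z c
      rw [← map_add, ← mk_mul, mul_add, map_add]; rfl
    right_distrib := by
      intro a b c
      obtain ⟨a, rfl⟩ := mk_surjective K Y Z a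
      obtain ⟨b, rfl⟩ := mk_surjective K Y Z b
      obtain ⟨c, rfl⟩ := mk_surjective K Y Z c
      rw [← map_add, ← mk_mul, add_mul, map_add]; rfl
    zero_mul := by
      intro a
      obtain ⟨a, rfl⟩ := mk_surjective K Y Z a
      rw [← map_zero (mk K Y Z), ← mk_mul, zero_mul]
    mul_zero := by
      intro a
      obtain ⟨a, rfl⟩ := mk_surjective K Y Z a
      rw [← map_zero (mk K Y Z), ← mk_mul, mul_zero] }

instance instTowerFree (K : Type*) [Field K] (Y Z : Type*) :
    IsScalarTower K (Free K Y Z) (Free K Y Z) :=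
  ⟨by
    intro c a b
    obtain ⟨a, rfl⟩ := mk_surjective K Y Z a
    obtain ⟨b, rfl⟩ := mk_surjective K Y Z b
    simp only [smul_eq_mul]
    rw [← map_smul, ← mk_mul, ← mk_mul, ← map_smul, smul_mul_assoc]⟩

instance instSMulCommFree (K : Type*) [Field K] (Y Z : Type*) :
    SMulCommClass K (Free K Y Z) (Free K Y Z) :=
  ⟨by
    intro c a b
    obtain ⟨a, rfl⟩ := mk_surjective K Y Z a
    obtain ⟨b, rfl⟩ := mk_surjective K Y Z b
    simp only [smul_eq_mul]
    rw [← map_smul, ← mk_mul, ← mk_mul, ← map_smul, mul_smul_comm]⟩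

/-- The free generators. -/
def gen (K : Type*) [Field K] (Y Z : Type*) (x : Y ⊕ Z) : Free K Y Z :=
  mk K Y Z (FreeNonUnitalNonAssocAlgebra.of K x)

/-- The component of weight `m`: the span of the (classes of) monomials of weight `m`, where
each generator `x` has weight `w x`. -/
def component (K : Type*) [Field K] {Y Z M : Type*} [Add M] (w : Y ⊕ Z → M) (m : M) :
    Submodule K (Free K Y Z) :=
  (absComponent K w m).map (mk K Y Z)

/-! ### The Hilbert series -/

/-- The multigraded Hilbert series of the free bicommutative superalgebra on `p` even and `q` odd
generators: the degree of each generator is counted separately. The variable `Sum.inl i` stands for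
`u_i` and `Sum.inr j` for `v_j`. -/
def multigradedHilbertSeries (K : Type*) [Field K] (p q : ℕ) :
    MvPowerSeries (Fin p ⊕ Fin q) ℚ := fun d =>
  (Module.finrank K (component K (fun x : Fin p ⊕ Fin q => Finsupp.single x (1 : ℕ)) d) : ℚ)

/-- The weights of the bigrading: `(1,0)` for even and `(0,1)` for odd generators. -/
def biWeight (p q : ℕ) : Fin p ⊕ Fin q → (Fin 2 →₀ ℕ) :=
  Sum.elim (fun _ => Finsupp.single 0 1) (fun _ => Finsupp.single 1 1)

/-- The bigraded Hilbert series, which counts the degrees in the even and in the odd generators.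
The variables `0` and `1` stand for `u` and `v`. -/
def bigradedHilbertSeries (K : Type*) [Field K] (p q : ℕ) : MvPowerSeries (Fin 2) ℚ := fun d =>
  (Module.finrank K (component K (biWeight p q) d) : ℚ)

/-- The Hilbert series for the total degree. -/
def gradedHilbertSeries (K : Type*) [Field K] (p q : ℕ) : PowerSeries ℚ :=
  PowerSeries.mk fun n =>
    (Module.finrank K (component K (fun _ : Fin p ⊕ Fin q => (1 : ℕ)) n) : ℚ)

/-! ### Basic facts: the object is free, is graded, and has finite-dimensional components -/

/-- The quotient map as an algebra homomorphism. -/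
def mkHom (K : Type*) [Field K] (Y Z : Type*) :
    FreeNonUnitalNonAssocAlgebra K (Y ⊕ Z) →ₙₐ[K] Free K Y Z :=
  { toFun := mk K Y Z
    map_smul' := map_smul (mk K Y Z)
    map_zero' := map_zero (mk K Y Z)
    map_add' := map_add (mk K Y Z)
    map_mul' := mk_mul K Y Z }

theorem relIdeal_le {K : Type*} [Field K] {Y Z A : Type*} [NonUnitalNonAssocRing A] [Module K A]
    (f : FreeNonUnitalNonAssocAlgebra K (Y ⊕ Z) →ₙₐ[K] A)
    (hf : ∀ r, IsRelator K Y Z r → f r = 0) {a} (ha : a ∈ relIdeal K Y Z) : f a = 0 := by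
  rw [relIdeal, Submodule.mem_sInf] at ha
  refine ha (LinearMap.ker (f : FreeNonUnitalNonAssocAlgebra K (Y ⊕ Z) →ₗ[K] A))
    ⟨fun r hr => hf r hr, fun a h b => ?_⟩
  have h' : f a = 0 := h
  constructor
  · change f (b * a) = 0
    rw [map_mul, h', mul_zero]
  · change f (a * b) = 0
    rw [map_mul, h', zero_mul]

/-- Algebra maps that kill the relators factor through the quotient. -/
def descend {K : Type*} [Field K] {Y Z A : Type*} [NonUnitalNonAssocRing A] [Module K A]
    (f : FreeNonUnitalNonAssocAlgebra K (Y ⊕ Z) →ₙₐ[K] A)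
    (hf : ∀ r, IsRelator K Y Z r → f r = 0) : Free K Y Z →ₙₐ[K] A :=
  { toFun := (relIdeal K Y Z).liftQ (f : FreeNonUnitalNonAssocAlgebra K (Y ⊕ Z) →ₗ[K] A)
      (fun _ ha => relIdeal_le f hf ha)
    map_smul' := fun c x => by
      exact map_smul ((relIdeal K Y Z).liftQ _ _) c x
    map_zero' := map_zero ((relIdeal K Y Z).liftQ _ _)
    map_add' := map_add ((relIdeal K Y Z).liftQ _ _)
    map_mul' := by
      intro a b
      obtain ⟨a, rfl⟩ := mk_surjective K Y Z a
      obtain ⟨b, rfl⟩ := mk_surjective K Y Z b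
      exact map_mul f a b }

theorem descend_mk {K : Type*} [Field K] {Y Z A : Type*} [NonUnitalNonAssocRing A] [Module K A]
    (f : FreeNonUnitalNonAssocAlgebra K (Y ⊕ Z) →ₙₐ[K] A)
    (hf : ∀ r, IsRelator K Y Z r → f r = 0) (a) : descend f hf (mk K Y Z a) = f a := rfl

theorem single_mul' {K : Type*} [Field K] {X : Type*} (s t : FreeMagma X) :
    (MonoidAlgebra.single s 1 * MonoidAlgebra.single t 1 : FreeNonUnitalNonAssocAlgebra K X) =
      MonoidAlgebra.single (s * t) 1 := by
  rw [MonoidAlgebra.single_mul_single, one_mul]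

theorem absComponent_mul {K : Type*} [Field K] {X M : Type*} [Add M] (w : X → M) {i j : M}
    {a b : FreeNonUnitalNonAssocAlgebra K X} (ha : a ∈ absComponent K w i)
    (hb : b ∈ absComponent K w j) : a * b ∈ absComponent K w (i + j) := by
  induction ha using Submodule.span_induction with
  | mem x hx =>
    obtain ⟨s, hs, rfl⟩ := hx
    induction hb using Submodule.span_induction with
    | mem y hy =>
      obtain ⟨t, ht, rfl⟩ := hy
      refine Submodule.subset_span ⟨s * t, ?_, (single_mul' s t).symm⟩
      change wt w s + wt w t = i + j
      rw [hs, ht]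
    | zero => rw [mul_zero]; exact zero_mem _
    | add x y _ _ hx hy => rw [mul_add]; exact add_mem hx hy
    | smul c x _ hx => rw [mul_smul_comm]; exact Submodule.smul_mem _ _ hx
  | zero => rw [zero_mul]; exact zero_mem _
  | add x y _ _ hx hy => rw [add_mul]; exact add_mem hx hy
  | smul c x _ hx => rw [smul_mul_assoc]; exact Submodule.smul_mem _ _ hx

/-- A degree-preserving map of generators extends to a degree-preserving algebra map. -/
theorem lift_mem {K : Type*} [Field K] {X M A : Type*} [Add M] [NonUnitalNonAssocRing A]
    [Module K A] [IsScalarTower K A A] [SMulCommClass K A A] (w : X → M) (𝒜 : M → Submodule K A)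
    (hmul : ∀ {i j : M} {x y : A}, x ∈ 𝒜 i → y ∈ 𝒜 j → x * y ∈ 𝒜 (i + j))
    (f : FreeNonUnitalNonAssocAlgebra K X →ₙₐ[K] A)
    (hf : ∀ x, f (FreeNonUnitalNonAssocAlgebra.of K x) ∈ 𝒜 (w x)) {m : M}
    {a : FreeNonUnitalNonAssocAlgebra K X} (ha : a ∈ absComponent K w m) : f a ∈ 𝒜 m := by
  have key : ∀ t : FreeMagma X, f (MonoidAlgebra.single t 1) ∈ 𝒜 (wt w t) := by
    intro t
    induction t with
    | ih1 x => exact hf x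
    | ih2 s t hs ht =>
      rw [← single_mul', map_mul]
      exact hmul hs ht
  induction ha using Submodule.span_induction with
  | mem x hx =>
    obtain ⟨s, hs, rfl⟩ := hx
    have := key s
    rwa [show wt w s = m from hs] at this
  | zero => rw [map_zero]; exact zero_mem _
  | add x y _ _ hx hy => rw [map_add]; exact add_mem hx hy
  | smul c x _ hx => rw [map_smul]; exact Submodule.smul_mem _ _ hx

/-- Universal property: a parity-preserving map of the generators into a bicommutative superalgebra
extends uniquely to an algebra homomorphism, and this homomorphism preserves parity. -/
theorem existsUnique_lift {K : Type*} [Field K] {Y Z A : Type*} [NonUnitalNonAssocRing A]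
    [Module K A] [IsScalarTower K A A] [SMulCommClass K A A] {𝒜 : ZMod 2 → Submodule K A}
    (h𝒜 : IsBicommutativeSuperalgebra K 𝒜) (g : Y ⊕ Z → A)
    (hg : ∀ x, g x ∈ 𝒜 (parityWeight Y Z x)) :
    ∃! φ : Free K Y Z →ₙₐ[K] A, (∀ x, φ (gen K Y Z x) = g x) ∧
      ∀ i, ∀ a ∈ component K (parityWeight Y Z) i, φ a ∈ 𝒜 i := by
  have hl : ∀ {i a}, a ∈ absComponent K (parityWeight Y Z) i →
      FreeNonUnitalNonAssocAlgebra.lift K g a ∈ 𝒜 i := fun ha =>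
    lift_mem (parityWeight Y Z) 𝒜 h𝒜.mul_mem _
      (fun x => by rw [FreeNonUnitalNonAssocAlgebra.lift_of_apply]; exact hg x) ha
  refine ⟨descend (FreeNonUnitalNonAssocAlgebra.lift K g) ?_, ⟨?_, ?_⟩, ?_⟩
  · rintro _ (⟨hx, hy, hz⟩ | ⟨hx, hy, hz⟩)
    · simp only [map_sub, map_smul, map_mul]
      rw [h𝒜.left_comm (hl hx) (hl hy) (hl hz), sub_self]
    · simp only [map_sub, map_smul, map_mul]
      rw [h𝒜.right_comm (hl hx) (hl hy) (hl hz), sub_self]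
  · intro x
    rw [gen, descend_mk, FreeNonUnitalNonAssocAlgebra.lift_of_apply]
  · rintro i _ ⟨a, ha, rfl⟩
    rw [descend_mk]
    exact hl ha
  · rintro ψ ⟨hψ, -⟩
    have h2 : ψ.comp (mkHom K Y Z) = FreeNonUnitalNonAssocAlgebra.lift K g := by
      rw [← FreeNonUnitalNonAssocAlgebra.lift_unique]
      funext x
      exact hψ x
    ext a
    obtain ⟨a, rfl⟩ := mk_surjective K Y Z a
    exact DFunLike.congr_fun h2 a

/-- The components of `Free K Y Z` multiply according to their weights. -/
theorem component_mul {K : Type*} [Field K] {Y Z M : Type*} [Add M] (w : Y ⊕ Z → M) {i j : M}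
    {a b : Free K Y Z} (ha : a ∈ component K w i) (hb : b ∈ component K w j) :
    a * b ∈ component K w (i + j) := by
  obtain ⟨a, ha, rfl⟩ := ha
  obtain ⟨b, hb, rfl⟩ := hb
  exact ⟨a * b, absComponent_mul w ha hb, mk_mul K Y Z a b⟩

/-- There are finitely many monomials of a given length in finitely many letters. -/
theorem finite_length {X : Type*} [Finite X] (n : ℕ) :
    {t : FreeMagma X | wt (fun _ => (1 : ℕ)) t ≤ n}.Finite := by
  have hpos : ∀ t : FreeMagma X, 1 ≤ wt (fun _ => (1 : ℕ)) t := by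
    intro t
    induction t with
    | ih1 x => exact le_refl 1
    | ih2 s t hs ht => exact le_trans hs (Nat.le_add_right _ _)
  induction n with
  | zero =>
    convert Set.finite_empty
    ext t
    have := hpos t
    simp only [Set.mem_ofPred_eq, Set.mem_empty_iff_false, iff_false]
    omega
  | succ n ih =>
    refine ((Set.finite_range (FreeMagma.of : X → FreeMagma X)).union
      (Set.Finite.image2 FreeMagma.mul ih ih)).subset ?_
    rintro (x | ⟨s, t⟩) ht
    · exact Or.inl ⟨x, rfl⟩
    · have h : wt (fun _ => (1 : ℕ)) s + wt (fun _ => (1 : ℕ)) t ≤ n + 1 := ht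
      have h1 := hpos s
      have h2 := hpos t
      exact Or.inr ⟨s, show wt (fun _ => (1 : ℕ)) s ≤ n by omega, t, show wt (fun _ => (1 : ℕ)) t ≤ n by omega, rfl⟩

/-- If an additive functional gives every generator degree one, the components are
finite-dimensional. -/
theorem finite_component {K : Type*} [Field K] {Y Z M : Type*} [Finite Y] [Finite Z]
    [AddMonoid M] (w : Y ⊕ Z → M) (l : M →+ ℕ) (hl : ∀ x, l (w x) = 1) (m : M) :
    Module.Finite K (component K w m) := by
  have hw : ∀ t : FreeMagma (Y ⊕ Z), wt (fun _ => (1 : ℕ)) t = l (wt w t) := by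
    intro t
    induction t with
    | ih1 x => exact (hl x).symm
    | ih2 s t hs ht =>
      change wt (fun _ => (1 : ℕ)) s + wt (fun _ => (1 : ℕ)) t = l (wt w s + wt w t)
      rw [hs, ht, map_add]
  have hfin : {t : FreeMagma (Y ⊕ Z) | wt w t = m}.Finite :=
    (finite_length (l m)).subset fun t ht => by
      have ht' : wt w t = m := ht
      change wt (fun _ => (1 : ℕ)) t ≤ l m
      rw [hw, ht']
  have : Module.Finite K (absComponent K w m) :=
    FiniteDimensional.span_of_finite K (hfin.image (fun t => MonoidAlgebra.single t (1 : K)))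
  exact Module.Finite.map _ _

/-- The relators of monomials of the free algebra span the relators; so an algebra map that kills
them for monomials kills all of them. -/
theorem kills_of_monomials {K : Type*} [Field K] {Y Z A : Type*} [NonUnitalNonAssocRing A]
    [Module K A] [IsScalarTower K A A] [SMulCommClass K A A]
    (f : FreeNonUnitalNonAssocAlgebra K (Y ⊕ Z) →ₙₐ[K] A)
    (hl : ∀ r s t : FreeMagma (Y ⊕ Z),
      f (.single r 1) * (f (.single s 1) * f (.single t 1)) =
        sgn K (wt (parityWeight Y Z) r) (wt (parityWeight Y Z) s) •
          (f (.single s 1) * (f (.single r 1) * f (.single t 1))))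
    (hr : ∀ r s t : FreeMagma (Y ⊕ Z),
      (f (.single r 1) * f (.single s 1)) * f (.single t 1) =
        sgn K (wt (parityWeight Y Z) s) (wt (parityWeight Y Z) t) •
          ((f (.single r 1) * f (.single t 1)) * f (.single s 1)))
    (r) (h : IsRelator K Y Z r) : f r = 0 := by
  obtain @⟨i, j, k, x, y, z, hx, hy, hz⟩ | @⟨i, j, k, x, y, z, hx, hy, hz⟩ := h
  all_goals
    simp only [map_sub, map_smul, map_mul, sub_eq_zero]
    induction hx using Submodule.span_induction with
    | zero => simp
    | add a b _ _ ha hb => simp only [map_add, add_mul, mul_add, smul_add, ha, hb]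
    | smul c a _ ha =>
      simp only [map_smul, smul_mul_assoc, mul_smul_comm, ha]
      try rw [smul_comm]
    | mem a ha => ?_
    obtain ⟨a, ha, rfl⟩ := ha
    induction hy using Submodule.span_induction with
    | zero => simp
    | add a b _ _ ha hb => simp only [map_add, add_mul, mul_add, smul_add, ha, hb]
    | smul c a _ ha =>
      simp only [map_smul, smul_mul_assoc, mul_smul_comm, ha]
      try rw [smul_comm]
    | mem b hb => ?_
    obtain ⟨b, hb, rfl⟩ := hb
    induction hz using Submodule.span_induction with
    | zero => simp
    | add a b _ _ ha hb => simp only [map_add, add_mul, mul_add, smul_add, ha, hb]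
    | smul c a _ ha =>
      simp only [map_smul, smul_mul_assoc, mul_smul_comm, ha]
      try rw [smul_comm]
    | mem c hc => ?_
    obtain ⟨c, hc, rfl⟩ := hc
    change wt _ a = i at ha
    change wt _ b = j at hb
    change wt _ c = k at hc
    subst ha hb hc
    first
      | exact hl a b c
      | exact hr a b c

/-- Elements of parity components satisfy the two super-identities in `Free K Y Z`. -/
theorem free_left_comm {K : Type*} [Field K] {Y Z : Type*} {i j k : ZMod 2} {x y z : Free K Y Z}
    (hx : x ∈ component K (parityWeight Y Z) i) (hy : y ∈ component K (parityWeight Y Z) j)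
    (hz : z ∈ component K (parityWeight Y Z) k) :
    x * (y * z) = sgn K i j • (y * (x * z)) := by
  obtain ⟨x, hx, rfl⟩ := hx
  obtain ⟨y, hy, rfl⟩ := hy
  obtain ⟨z, hz, rfl⟩ := hz
  simp only [← mk_mul, ← map_smul]
  exact mk_eq_iff.2 (relator_mem (IsRelator.left hx hy hz))

theorem free_right_comm {K : Type*} [Field K] {Y Z : Type*} {i j k : ZMod 2} {x y z : Free K Y Z}
    (hx : x ∈ component K (parityWeight Y Z) i) (hy : y ∈ component K (parityWeight Y Z) j)
    (hz : z ∈ component K (parityWeight Y Z) k) :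
    (x * y) * z = sgn K j k • ((x * z) * y) := by
  obtain ⟨x, hx, rfl⟩ := hx
  obtain ⟨y, hy, rfl⟩ := hy
  obtain ⟨z, hz, rfl⟩ := hz
  simp only [← mk_mul, ← map_smul]
  exact mk_eq_iff.2 (relator_mem (IsRelator.right hx hy hz))

theorem monomial_mem {K : Type*} [Field K] {X M : Type*} [Add M] (w : X → M) (t : FreeMagma X) :
    MonoidAlgebra.single t (1 : K) ∈ absComponent K w (wt w t) :=
  Submodule.subset_span ⟨t, rfl, rfl⟩

open scoped TensorProduct in
/-- The map that records the weight of a monomial, before passing to the quotient. -/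
def absWeigh (K : Type*) [Field K] {Y Z M : Type*} [AddCommMonoid M] (w : Y ⊕ Z → M) :
    FreeNonUnitalNonAssocAlgebra K (Y ⊕ Z) →ₙₐ[K] Free K Y Z ⊗[K] AddMonoidAlgebra K M :=
  FreeNonUnitalNonAssocAlgebra.lift K
    (fun x => gen K Y Z x ⊗ₜ[K] AddMonoidAlgebra.single (w x) (1 : K))

open scoped TensorProduct in
theorem absWeigh_single {K : Type*} [Field K] {Y Z M : Type*} [AddCommMonoid M] (w : Y ⊕ Z → M)
    (t : FreeMagma (Y ⊕ Z)) :
    absWeigh K w (MonoidAlgebra.single t 1) =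
      mk K Y Z (MonoidAlgebra.single t 1) ⊗ₜ[K] AddMonoidAlgebra.single (wt w t) (1 : K) := by
  induction t with
  | ih1 x => exact FreeNonUnitalNonAssocAlgebra.lift_of_apply (R := K) _ x
  | ih2 s t hs ht =>
    rw [← single_mul', map_mul, hs, ht, Algebra.TensorProduct.tmul_mul_tmul, mk_mul,
      AddMonoidAlgebra.single_mul_single, one_mul]
    rfl

open scoped TensorProduct in
/-- The coaction `a ↦ a ⊗ e^m` for `a` of weight `m`. -/
def weigh (K : Type*) [Field K] {Y Z M : Type*} [AddCommMonoid M] (w : Y ⊕ Z → M) :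
    Free K Y Z →ₙₐ[K] Free K Y Z ⊗[K] AddMonoidAlgebra K M :=
  descend (absWeigh K w) (kills_of_monomials _
    (by
      intro r s t
      simp only [absWeigh_single, Algebra.TensorProduct.tmul_mul_tmul,
        AddMonoidAlgebra.single_mul_single, one_mul]
      rw [free_left_comm ⟨_, monomial_mem _ r, rfl⟩ ⟨_, monomial_mem _ s, rfl⟩
        ⟨_, monomial_mem _ t, rfl⟩, TensorProduct.smul_tmul', add_left_comm])
    (by
      intro r s t
      simp only [absWeigh_single, Algebra.TensorProduct.tmul_mul_tmul,
        AddMonoidAlgebra.single_mul_single, one_mul]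
      rw [free_right_comm ⟨_, monomial_mem _ r, rfl⟩ ⟨_, monomial_mem _ s, rfl⟩
        ⟨_, monomial_mem _ t, rfl⟩, TensorProduct.smul_tmul', add_right_comm]))

open scoped TensorProduct in
theorem weigh_component {K : Type*} [Field K] {Y Z M : Type*} [AddCommMonoid M] (w : Y ⊕ Z → M)
    {m : M} {a : Free K Y Z} (ha : a ∈ component K w m) :
    weigh K w a = a ⊗ₜ[K] AddMonoidAlgebra.single m (1 : K) := by
  obtain ⟨a, ha, rfl⟩ := ha
  induction ha using Submodule.span_induction with
  | mem x hx =>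
    obtain ⟨s, hs, rfl⟩ := hx
    change wt w s = m at hs
    subst hs
    exact absWeigh_single w s
  | zero => rw [map_zero, map_zero, TensorProduct.zero_tmul]
  | add x y _ _ hx hy => rw [map_add, map_add, TensorProduct.add_tmul, hx, hy]
  | smul c x _ hx => rw [map_smul, map_smul, hx, TensorProduct.smul_tmul']

open scoped TensorProduct in
/-- The free bicommutative superalgebra is the direct sum of its components, for every assignment
of weights to the generators. -/
theorem isInternal_component (K : Type*) [Field K] {Y Z M : Type*} [AddCommMonoid M]
    [DecidableEq M] (w : Y ⊕ Z → M) :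
    DirectSum.IsInternal (fun m : M => component K w m) := by
  have hcoeff : ∀ m : M, ∃ P : Free K Y Z →ₗ[K] Free K Y Z,
      ∀ (n : M) (a : Free K Y Z), a ∈ component K w n → P a = if n = m then a else 0 := by
    intro m
    let c : AddMonoidAlgebra K M →ₗ[K] K :=
      { toFun := fun f => f.coeff m
        map_add' := fun _ _ => rfl
        map_smul' := fun _ _ => rfl }
    refine ⟨(TensorProduct.rid K (Free K Y Z)).toLinearMap ∘ₗ
      (c.lTensor (Free K Y Z)) ∘ₗ (weigh K w : Free K Y Z →ₗ[K] _), ?_⟩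
    intro n a ha
    change TensorProduct.rid K (Free K Y Z) (c.lTensor (Free K Y Z) (weigh K w a)) = _
    rw [weigh_component w ha, LinearMap.lTensor_tmul, TensorProduct.rid_tmul]
    change (AddMonoidAlgebra.single n (1 : K)).coeff m • a = _
    split_ifs with h
    · subst h; simp
    · simp [h]
  choose P hP using hcoeff
  constructor
  · intro d e hde
    have key : ∀ (d : DirectSum M fun m => component K w m) (m : M),
        P m (DirectSum.coeAddMonoidHom (fun m => component K w m) d) = d m := by
      intro d m
      induction d using DirectSum.induction_on with
      | zero => simp
      | of n x =>
        rw [DirectSum.coeAddMonoidHom_of, hP m n x x.2]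
        split_ifs with h
        · subst h; simp
        · rw [DirectSum.of_eq_of_ne _ _ _ (Ne.symm h)]; rfl
      | add x y hx hy => rw [map_add, map_add, hx, hy]; rfl
    refine DFinsupp.ext fun m => Subtype.ext ?_
    rw [← key d m, ← key e m, hde]
  · intro a
    obtain ⟨a, rfl⟩ := mk_surjective K Y Z a
    induction a using MonoidAlgebra.induction_linear with
    | zero => exact ⟨0, by rw [map_zero, map_zero]⟩
    | add x y hx hy =>
      obtain ⟨d, hd⟩ := hx
      obtain ⟨e, he⟩ := hy
      exact ⟨d + e, by rw [map_add, map_add, hd, he]⟩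
    | single t r =>
      refine ⟨DirectSum.of (fun m => component K w m) (wt w t) ⟨mk K Y Z (.single t r), ?_⟩, ?_⟩
      · refine ⟨_, ?_, rfl⟩
        have := Submodule.smul_mem _ r (monomial_mem (K := K) w t)
        rwa [MonoidAlgebra.smul_single, smul_eq_mul, mul_one] at this
      · rw [DirectSum.coeAddMonoidHom_of]

/-- `Free K Y Z` is itself a bicommutative superalgebra. -/
theorem isBicommutativeSuperalgebra_free (K : Type*) [Field K] (Y Z : Type*) :
    IsBicommutativeSuperalgebra K (fun i : ZMod 2 => component K (parityWeight Y Z) i) where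
  isInternal := isInternal_component K _
  mul_mem := component_mul _
  left_comm := free_left_comm
  right_comm := free_right_comm

/-- The generators are homogeneous of the prescribed weight. -/
theorem gen_mem (K : Type*) [Field K] {Y Z M : Type*} [Add M] (w : Y ⊕ Z → M) (x : Y ⊕ Z) :
    gen K Y Z x ∈ component K w (w x) :=
  ⟨_, monomial_mem w (FreeMagma.of x), rfl⟩

/-- The dimensions in the three Hilbert series are finite. -/
theorem finite_components (K : Type*) [Field K] (p q : ℕ) :
    (∀ d, Module.Finite K
      (component K (fun x : Fin p ⊕ Fin q => Finsupp.single x (1 : ℕ)) d)) ∧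
    (∀ d, Module.Finite K (component K (biWeight p q) d)) ∧
    (∀ n, Module.Finite K (component K (fun _ : Fin p ⊕ Fin q => (1 : ℕ)) n)) := by
  refine ⟨finite_component _ Finsupp.degree ?_, finite_component _ Finsupp.degree ?_,
    finite_component _ (AddMonoidHom.id ℕ) fun _ => rfl⟩
  · intro x
    simp
  · rintro (i | j) <;> simp [biWeight]

end BicommSuper

end

/-!
The Hilbert series is computed from an explicit homogeneous basis of the free bicommutative
superalgebra `F`: the generators, together with one monomial for each pair `(m, n)` of nonempty
commutative monomials in which no odd generator is repeated. The pair lists the letters that act by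
left and by right multiplication, so `F ^ 2` has the size of the tensor square of the augmentation
ideal of the free supercommutative algebra, whose generating function is
`∏ (1 - u_i)⁻¹ ∏ (1 + v_j) - 1`.

*Spanning.* In `F` the left multiplications supercommute with each other, and so do the right
multiplications; moreover left and right multiplications commute on products
(`Similar.assoc_of_mul`). Since `(a b) v = ± (a v) b` and `v (a b) = ± a (v b)`, induction on
monomials shows that every monomial of degree at least two is, up to sign, a word
`R_{r_k} ⋯ R_{r_1} L_{l_1} ⋯ L_{l_n} y` in generators (`eq_of_or_hasNormalForm`). Such a word depends
up to sign only on the multisets `{l_1, …, l_n}` and `{y, r_1, …, r_k}` (`similar_word_of_perm`), and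
it is zero if one of them repeats an odd letter, since `2 ≠ 0` (`mon_word_eq_zero`).

*Independence.* Let `T` be the super tensor square of the free supercommutative algebra, realized by
its monomial basis with a multiplication twisted by signs. For any associative supercommutative
algebra `T`, the pairs `(l, r)` of elements of `T` with the product `(l, r) (l', r') = (l r', l r')`
form a bicommutative superalgebra. Sending a generator `x` to `(x ⊗ 1, 1 ⊗ x)` maps the word above to
a nonzero multiple of the monomial `m ⊗ n` (`toPair_word`), and distinct basis elements go to
distinct monomials. Hence the dimension of a component is a number of basis elements
(`finrank_component`), for every grading.

*Counting.* Generating functions turn disjoint unions into sums and finite products into products,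
which gives the series in one stroke for every assignment of variables to the generators
(`hilbertSeries_eq`); the three formulas are special cases.
-/

namespace BicommSuper

/-! ### Monomials up to nonzero scalars -/

/-- The class of a nonassociative monomial in the free bicommutative superalgebra. -/
noncomputable def mon (K : Type*) [Field K] {Y Z : Type*} (t : FreeMagma (Y ⊕ Z)) : Free K Y Z :=
  mk K Y Z (MonoidAlgebra.single t 1)

theorem mon_mul (K : Type*) [Field K] {Y Z : Type*} (s t : FreeMagma (Y ⊕ Z)) :
    mon K (s * t) = mon K s * mon K t := by
  rw [mon, ← single_mul', mk_mul]
  rfl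

theorem mon_mem (K : Type*) [Field K] {Y Z M : Type*} [Add M] (w : Y ⊕ Z → M)
    (t : FreeMagma (Y ⊕ Z)) : mon K t ∈ component K w (wt w t) :=
  ⟨_, monomial_mem w t, rfl⟩

/-- The multiset of letters of a nonassociative monomial. -/
def content {X : Type*} (t : FreeMagma X) : Multiset X := wt (fun x => {x}) t

theorem content_of {X : Type*} (x : X) : content (FreeMagma.of x) = {x} := rfl

theorem content_mul {X : Type*} (s t : FreeMagma X) : content (s * t) = content s + content t := rfl

theorem wt_of {X M : Type*} [Add M] (w : X → M) (x : X) : wt w (FreeMagma.of x) = w x := rfl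

theorem wt_mul {X M : Type*} [Add M] (w : X → M) (s t : FreeMagma X) :
    wt w (s * t) = wt w s + wt w t := rfl

theorem wt_eq_sum_content {X M : Type*} [AddCommMonoid M] (w : X → M) (t : FreeMagma X) :
    wt w t = ((content t).map w).sum := by
  induction t with
  | ih1 x => simp [wt_of, content_of]
  | ih2 s t hs ht => rw [wt_mul, content_mul, Multiset.map_add, Multiset.sum_add, hs, ht]

theorem sgn_ne_zero (K : Type*) [Field K] (i j : ZMod 2) : sgn K i j ≠ 0 :=
  pow_ne_zero _ (neg_ne_zero.2 one_ne_zero)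

/-- Two monomials are similar if they have the same letters and their classes in the free
bicommutative superalgebra agree up to a nonzero scalar. -/
def Similar (K : Type*) [Field K] {Y Z : Type*} (s t : FreeMagma (Y ⊕ Z)) : Prop :=
  content s = content t ∧ ∃ c : K, c ≠ 0 ∧ mon K s = c • mon K t

namespace Similar

variable {K : Type*} [Field K] {Y Z : Type*} {s t u : FreeMagma (Y ⊕ Z)}

theorem refl (t : FreeMagma (Y ⊕ Z)) : Similar K t t := ⟨rfl, 1, one_ne_zero, (one_smul K _).symm⟩

theorem symm (h : Similar K s t) : Similar K t s := by
  obtain ⟨h, c, hc, hst⟩ := h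
  exact ⟨h.symm, c⁻¹, inv_ne_zero hc, by rw [hst, inv_smul_smul₀ hc]⟩

theorem trans (h : Similar K s t) (h' : Similar K t u) : Similar K s u := by
  obtain ⟨h, c, hc, hst⟩ := h
  obtain ⟨h', c', hc', htu⟩ := h'
  exact ⟨h.trans h', c * c', mul_ne_zero hc hc', by rw [hst, htu, mul_smul]⟩

theorem mul_left (a : FreeMagma (Y ⊕ Z)) (h : Similar K s t) : Similar K (a * s) (a * t) := by
  obtain ⟨h, c, hc, hst⟩ := h
  exact ⟨by rw [content_mul, content_mul, h], c, hc, by rw [mon_mul, mon_mul, hst, mul_smul_comm]⟩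

theorem mul_right (a : FreeMagma (Y ⊕ Z)) (h : Similar K s t) : Similar K (s * a) (t * a) := by
  obtain ⟨h, c, hc, hst⟩ := h
  exact ⟨by rw [content_mul, content_mul, h], c, hc, by rw [mon_mul, mon_mul, hst, smul_mul_assoc]⟩

theorem left_comm (a b c : FreeMagma (Y ⊕ Z)) : Similar K (a * (b * c)) (b * (a * c)) := by
  refine ⟨by simp only [content_mul, add_left_comm],
    sgn K (wt (parityWeight Y Z) a) (wt (parityWeight Y Z) b), sgn_ne_zero K _ _, ?_⟩
  simp only [mon_mul]
  exact free_left_comm (mon_mem K _ a) (mon_mem K _ b) (mon_mem K _ c)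

theorem right_comm (a b c : FreeMagma (Y ⊕ Z)) : Similar K (a * b * c) (a * c * b) := by
  refine ⟨by simp only [content_mul, add_right_comm],
    sgn K (wt (parityWeight Y Z) b) (wt (parityWeight Y Z) c), sgn_ne_zero K _ _, ?_⟩
  simp only [mon_mul]
  exact free_right_comm (mon_mem K _ a) (mon_mem K _ b) (mon_mem K _ c)

/-- Left and right multiplications commute on products. -/
theorem assoc_of_mul (x a b y : FreeMagma (Y ⊕ Z)) :
    Similar K (x * (a * b * y)) (x * (a * b) * y) :=
  (left_comm x (a * b) y).trans <| (right_comm a b (x * y)).trans <|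
    ((left_comm a x y).mul_right b).trans <| (right_comm x (a * y) b).trans <|
    (left_comm (x * b) a y).trans <| ((right_comm x b y).mul_left a).trans <|
    (left_comm a (x * y) b).trans <| right_comm x y (a * b)

end Similar

/-! ### Normal words -/

/-- The monomial `l₁(l₂(⋯(lₙ t)))`. -/
def mulLeftList {X : Type*} (l : List X) (t : FreeMagma X) : FreeMagma X :=
  l.foldr (fun x u => FreeMagma.of x * u) t

/-- The monomial `((t r₁)r₂ ⋯)rₙ`. -/
def mulRightList {X : Type*} (t : FreeMagma X) (r : List X) : FreeMagma X :=
  r.foldl (fun u x => u * FreeMagma.of x) t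

/-- The monomial obtained from the letter `y` by first multiplying from the left by the letters
of `l` and then from the right by the letters of `r`. -/
def word {X : Type*} (l : List X) (y : X) (r : List X) : FreeMagma X :=
  mulRightList (mulLeftList l (FreeMagma.of y)) r

section Lists

variable {X : Type*}

theorem mulLeftList_nil (t : FreeMagma X) : mulLeftList [] t = t := rfl

theorem mulLeftList_cons (x : X) (l : List X) (t : FreeMagma X) :
    mulLeftList (x :: l) t = FreeMagma.of x * mulLeftList l t := rfl

theorem mulLeftList_concat (l : List X) (x : X) (t : FreeMagma X) :
    mulLeftList (l ++ [x]) t = mulLeftList l (FreeMagma.of x * t) := by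
  simp [mulLeftList]

theorem mulRightList_nil (t : FreeMagma X) : mulRightList t [] = t := rfl

theorem mulRightList_cons (t : FreeMagma X) (x : X) (r : List X) :
    mulRightList t (x :: r) = mulRightList (t * FreeMagma.of x) r := rfl

theorem mulRightList_concat (t : FreeMagma X) (r : List X) (x : X) :
    mulRightList t (r ++ [x]) = mulRightList t r * FreeMagma.of x := by
  simp [mulRightList]

theorem content_mulLeftList (l : List X) (t : FreeMagma X) :
    content (mulLeftList l t) = l + content t := by
  induction l with
  | nil => simp [mulLeftList_nil]
  | cons x l ih =>
    rw [mulLeftList_cons, content_mul, content_of, ih, ← add_assoc, ← Multiset.cons_coe,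
      Multiset.singleton_add]

theorem content_mulRightList (t : FreeMagma X) (r : List X) :
    content (mulRightList t r) = content t + r := by
  induction r generalizing t with
  | nil => simp [mulRightList_nil]
  | cons x r ih =>
    rw [mulRightList_cons, ih, content_mul, content_of, add_assoc, ← Multiset.cons_coe,
      Multiset.singleton_add]

theorem content_word (l : List X) (y : X) (r : List X) :
    content (word l y r) = (l : Multiset X) + ((y :: r : List X) : Multiset X) := by
  rw [word, content_mulRightList, content_mulLeftList, content_of, add_assoc,
    Multiset.singleton_add, Multiset.cons_coe]

theorem exists_mulRightList_eq_mul (a b : FreeMagma X) (r : List X) :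
    ∃ c d, mulRightList (a * b) r = c * d := by
  induction r generalizing a b with
  | nil => exact ⟨a, b, rfl⟩
  | cons x r ih => exact ih _ _

theorem exists_mulLeftList_eq_mul (t : FreeMagma X) {l : List X} (hl : l ≠ []) :
    ∃ c d, mulLeftList l t = c * d := by
  cases l with
  | nil => exact absurd rfl hl
  | cons x l => exact ⟨_, _, rfl⟩

end Lists

section Reordering

variable {K : Type*} [Field K] {Y Z : Type*} {s t : FreeMagma (Y ⊕ Z)}

theorem Similar.mulLeftList (l : List (Y ⊕ Z)) (h : Similar K s t) :
    Similar K (mulLeftList l s) (mulLeftList l t) := by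
  induction l with
  | nil => exact h
  | cons x l ih => exact ih.mul_left _

theorem Similar.mulRightList (r : List (Y ⊕ Z)) (h : Similar K s t) :
    Similar K (mulRightList s r) (mulRightList t r) := by
  induction r generalizing s t with
  | nil => exact h
  | cons x r ih => exact ih (h.mul_right _)

theorem similar_mulLeftList_of_perm {l l' : List (Y ⊕ Z)} (h : l.Perm l')
    (t : FreeMagma (Y ⊕ Z)) : Similar K (mulLeftList l t) (mulLeftList l' t) := by
  induction h with
  | nil => exact Similar.refl _
  | cons x _ ih => exact ih.mul_left _
  | swap x y l => exact Similar.left_comm _ _ _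
  | trans _ _ h h' => exact h.trans h'

theorem similar_mulRightList_of_perm {r r' : List (Y ⊕ Z)} (h : r.Perm r')
    (t : FreeMagma (Y ⊕ Z)) : Similar K (mulRightList t r) (mulRightList t r') := by
  induction h generalizing t with
  | nil => exact Similar.refl _
  | cons x _ ih => exact ih _
  | swap x y r => exact (Similar.right_comm _ _ _).mulRightList r
  | trans _ _ h h' => exact (h t).trans (h' t)

/-- A left multiplication moves past right multiplications that are applied to a product. -/
theorem similar_mul_mulRightList (x a b : FreeMagma (Y ⊕ Z)) (r : List (Y ⊕ Z)) :
    Similar K (x * mulRightList (a * b) r) (mulRightList (x * (a * b)) r) := by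
  induction r using List.reverseRecOn with
  | nil => exact Similar.refl _
  | append_singleton r y ih =>
    obtain ⟨c, d, h⟩ := exists_mulRightList_eq_mul a b r
    rw [mulRightList_concat, mulRightList_concat]
    refine Similar.trans ?_ (ih.mul_right _)
    rw [h]
    exact Similar.assoc_of_mul _ _ _ _

theorem similar_mulLeftList_mulRightList (l : List (Y ⊕ Z)) (a b : FreeMagma (Y ⊕ Z))
    (r : List (Y ⊕ Z)) :
    Similar K (mulLeftList l (mulRightList (a * b) r)) (mulRightList (mulLeftList l (a * b)) r) := by
  induction l with
  | nil => exact Similar.refl _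
  | cons x l ih =>
    refine (ih.mul_left _).trans ?_
    have : ∃ c d, mulLeftList l (a * b) = c * d := by
      cases l with
      | nil => exact ⟨a, b, rfl⟩
      | cons y l => exact ⟨_, _, rfl⟩
    obtain ⟨c, d, h⟩ := this
    rw [mulLeftList_cons, h]
    exact similar_mul_mulRightList _ _ _ _

/-- A word can also be built by doing the right multiplications first. -/
theorem similar_word_concat (l : List (Y ⊕ Z)) (x y : Y ⊕ Z) (r : List (Y ⊕ Z)) :
    Similar K (word (l ++ [x]) y r) (mulLeftList l (mulRightList (FreeMagma.of x) (y :: r))) := by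
  rw [word, mulLeftList_concat, mulRightList_cons]
  exact (similar_mulLeftList_mulRightList _ _ _ _).symm

/-- Up to similarity, a word depends only on the multisets of its left and its right letters. -/
theorem similar_word_of_perm {l l' : List (Y ⊕ Z)} {y y' : Y ⊕ Z} {r r' : List (Y ⊕ Z)}
    (hl0 : l ≠ []) (hl : l.Perm l') (hr : (y :: r).Perm (y' :: r')) :
    Similar K (word l y r) (word l' y' r') := by
  refine Similar.trans ?_ ((similar_mulLeftList_of_perm hl _).mulRightList r')
  change Similar K (word l y r) (word l y' r')
  obtain ⟨l, x, rfl⟩ : ∃ l0 x, l = l0 ++ [x] :=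
    ⟨_, _, (List.dropLast_append_getLast hl0).symm⟩
  exact (similar_word_concat l x y r).trans <|
    ((similar_mulRightList_of_perm hr _).mulLeftList l).trans (similar_word_concat l x y' r').symm

/-- Being similar to a word with at least one left letter. -/
def HasNormalForm (K : Type*) [Field K] {Y Z : Type*} (t : FreeMagma (Y ⊕ Z)) : Prop :=
  ∃ l y r, l ≠ [] ∧ Similar K t (word l y r)

theorem HasNormalForm.of_similar (h : Similar K s t) (ht : HasNormalForm K t) :
    HasNormalForm K s := by
  obtain ⟨l, y, r, hl, ht⟩ := ht
  exact ⟨l, y, r, hl, h.trans ht⟩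

/-- By induction on `t`, since `(a b) v` is similar to `(a v) b` and `v (a b)` to `a (v b)`. -/
theorem HasNormalForm.mul (t : FreeMagma (Y ⊕ Z)) :
    ∀ v, HasNormalForm K v → HasNormalForm K (t * v) ∧ HasNormalForm K (v * t) := by
  induction t with
  | ih1 x =>
    rintro v ⟨l, y, r, hl, hv⟩
    constructor
    · refine ⟨x :: l, y, r, List.cons_ne_nil _ _, (hv.mul_left _).trans ?_⟩
      obtain ⟨c, d, h⟩ := exists_mulLeftList_eq_mul (FreeMagma.of y) hl
      rw [word, word, mulLeftList_cons, h]
      exact similar_mul_mulRightList _ _ _ _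
    · refine ⟨l, y, r ++ [x], hl, (hv.mul_right _).trans ?_⟩
      rw [word, word, mulRightList_concat]
      exact Similar.refl _
  | ih2 a b iha ihb =>
    intro v hv
    exact ⟨((ihb _ (iha v hv).1).2).of_similar (Similar.right_comm a b v),
      ((iha _ (ihb v hv).2).1).of_similar (Similar.left_comm v a b)⟩

theorem eq_of_or_hasNormalForm (t : FreeMagma (Y ⊕ Z)) :
    (∃ x, t = FreeMagma.of x) ∨ HasNormalForm K t := by
  induction t with
  | ih1 x => exact Or.inl ⟨x, rfl⟩
  | ih2 a b ha hb =>
    right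
    obtain ⟨x, rfl⟩ | ha := ha
    · obtain ⟨y, rfl⟩ | hb := hb
      · exact ⟨[x], y, [], List.cons_ne_nil _ _, Similar.refl _⟩
      · exact (HasNormalForm.mul _ _ hb).1
    · exact (HasNormalForm.mul _ _ ha).2

/-! ### Words with a repeated odd letter vanish -/

theorem eq_zero_of_eq_neg_smul (hK : ringChar K ≠ 2) {V : Type*} [AddCommGroup V] [Module K V]
    {v : V} (h : v = (-1 : K) • v) : v = 0 := by
  have h2 : (2 : K) • v = 0 := by
    rw [two_smul]
    nth_rewrite 1 [h]
    rw [neg_one_smul, neg_add_cancel]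
  exact (smul_eq_zero.1 h2).resolve_left (Ring.two_ne_zero hK)

theorem sgn_one_one : sgn K 1 1 = -1 := by
  have : (1 : ZMod 2).val = 1 := rfl
  rw [sgn, this, one_mul, pow_one]

theorem mon_odd_mul_odd_mul (hK : ringChar K ≠ 2) (z : Z) (t : FreeMagma (Y ⊕ Z)) :
    mon K (FreeMagma.of (Sum.inr z) * (FreeMagma.of (Sum.inr z) * t)) = 0 := by
  refine eq_zero_of_eq_neg_smul hK ?_
  have h := mon_mem K (parityWeight Y Z) (FreeMagma.of (Sum.inr z))
  have := free_left_comm h h (mon_mem K _ t)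
  simp only [mon_mul]
  rwa [← sgn_one_one]

theorem mon_mul_odd_mul_odd (hK : ringChar K ≠ 2) (z : Z) (t : FreeMagma (Y ⊕ Z)) :
    mon K (t * FreeMagma.of (Sum.inr z) * FreeMagma.of (Sum.inr z)) = 0 := by
  refine eq_zero_of_eq_neg_smul hK ?_
  have h := mon_mem K (parityWeight Y Z) (FreeMagma.of (Sum.inr z))
  have := free_right_comm (mon_mem K _ t) h h
  simp only [mon_mul]
  rwa [← sgn_one_one]

theorem Similar.mon_eq_zero (h : Similar K s t) (ht : mon K t = 0) : mon K s = 0 := by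
  obtain ⟨-, c, -, h⟩ := h
  rw [h, ht, smul_zero]

theorem mon_mulLeftList_eq_zero (l : List (Y ⊕ Z)) (ht : mon K t = 0) :
    mon K (mulLeftList l t) = 0 := by
  induction l with
  | nil => exact ht
  | cons x l ih => rw [mulLeftList_cons, mon_mul, ih, mul_zero]

theorem mon_mulRightList_eq_zero (r : List (Y ⊕ Z)) (ht : mon K t = 0) :
    mon K (mulRightList t r) = 0 := by
  induction r generalizing t with
  | nil => exact ht
  | cons x r ih => exact ih (by rw [mon_mul, ht, zero_mul])

/-- A multiset of letters is squarefree in the odd letters. -/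
def Admissible {Y Z : Type*} [DecidableEq Y] [DecidableEq Z] (m : Multiset (Y ⊕ Z)) : Prop :=
  ∀ z : Z, m.count (Sum.inr z) ≤ 1

theorem exists_perm_of_not_admissible [DecidableEq Y] [DecidableEq Z] {l : List (Y ⊕ Z)}
    (h : ¬ Admissible (l : Multiset (Y ⊕ Z))) :
    ∃ (z : Z) (l' : List (Y ⊕ Z)), l.Perm (Sum.inr z :: Sum.inr z :: l') := by
  simp only [Admissible, not_forall, not_le] at h
  obtain ⟨z, hz⟩ := h
  have : Multiset.replicate 2 (Sum.inr z) ≤ (l : Multiset (Y ⊕ Z)) :=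
    Multiset.le_count_iff_replicate_le.1 hz
  obtain ⟨m, hm⟩ := Multiset.le_iff_exists_add.1 this
  refine ⟨z, m.toList, Multiset.coe_eq_coe.1 ?_⟩
  rw [hm, ← Multiset.cons_coe, ← Multiset.cons_coe, Multiset.coe_toList]
  simp [Multiset.replicate_succ]

theorem mon_word_eq_zero [DecidableEq Y] [DecidableEq Z] (hK : ringChar K ≠ 2)
    {l : List (Y ⊕ Z)} {y : Y ⊕ Z} {r : List (Y ⊕ Z)} (hl : l ≠ [])
    (h : ¬ (Admissible (l : Multiset (Y ⊕ Z)) ∧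
      Admissible ((y :: r : List (Y ⊕ Z)) : Multiset (Y ⊕ Z)))) :
    mon K (word l y r) = 0 := by
  rw [not_and_or] at h
  obtain h | h := h
  · obtain ⟨z, l', hl'⟩ := exists_perm_of_not_admissible h
    exact ((similar_mulLeftList_of_perm hl' _).mulRightList r).mon_eq_zero
      (mon_mulRightList_eq_zero _ (mon_odd_mul_odd_mul hK z _))
  · obtain ⟨z, r', hr'⟩ := exists_perm_of_not_admissible h
    obtain ⟨l, x, rfl⟩ : ∃ l0 x, l = l0 ++ [x] :=
    ⟨_, _, (List.dropLast_append_getLast hl).symm⟩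
    refine (similar_word_concat l x y r).mon_eq_zero (mon_mulLeftList_eq_zero _ ?_)
    exact (similar_mulRightList_of_perm hr' _).mon_eq_zero
      (mon_mulRightList_eq_zero r' (mon_mul_odd_mul_odd hK z _))

end Reordering


/-! ### A twisted monomial algebra -/

section Model

variable {K : Type*} [Field K] {Y Z : Type*}

theorem Admissible.of_add_left [DecidableEq Y] [DecidableEq Z] {m m' : Multiset (Y ⊕ Z)}
    (h : Admissible (m + m')) : Admissible m := fun z =>
  (Multiset.count_le_of_le _ (Multiset.le_add_right m m')).trans (h z)

theorem Admissible.of_add_right [DecidableEq Y] [DecidableEq Z] {m m' : Multiset (Y ⊕ Z)}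
    (h : Admissible (m + m')) : Admissible m' := fun z =>
  (Multiset.count_le_of_le _ (Multiset.le_add_left m' m)).trans (h z)

theorem admissible_zero [DecidableEq Y] [DecidableEq Z] :
    Admissible (0 : Multiset (Y ⊕ Z)) := fun z => by simp

theorem admissible_singleton [DecidableEq Y] [DecidableEq Z] (x : Y ⊕ Z) :
    Admissible {x} := fun z => by
  rw [Multiset.count_singleton]
  split_ifs <;> simp

/-- The sign `(-1)^a`. -/
def sign (K : Type*) [Field K] (a : ZMod 2) : K := (-1) ^ a.val

theorem sign_add (K : Type*) [Field K] (a b : ZMod 2) :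
    sign K (a + b) = sign K a * sign K b := by
  have h : ∀ a : ZMod 2, a = 0 ∨ a = 1 := by decide
  have h0 : sign K 0 = 1 := pow_zero _
  have h1 : sign K 1 = -1 := pow_one _
  obtain rfl | rfl := h a <;> obtain rfl | rfl := h b
  · simp [h0]
  · simp [h0]
  · simp [h0]
  · rw [show (1 + 1 : ZMod 2) = 0 from rfl, h0, h1, neg_mul_neg, one_mul]

theorem sign_ne_zero (K : Type*) [Field K] (a : ZMod 2) : sign K a ≠ 0 :=
  pow_ne_zero _ (neg_ne_zero.2 one_ne_zero)

theorem sgn_eq_sign (K : Type*) [Field K] (i j : ZMod 2) : sgn K i j = sign K (i * j) := by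
  have h : ∀ i j : ZMod 2, i.val * j.val = (i * j).val := by decide
  rw [sgn, sign, h]

/-- The pairs of commutative monomials, which index a basis of the super tensor square of the free
supercommutative algebra. -/
abbrev TensorMonomial (Y Z : Type*) : Type _ := Multiset (Y ⊕ Z) × Multiset (Y ⊕ Z)

/-- Pairs `(l, r)` of elements of the super tensor square, with the product
`(l, r) (l', r') = (l r', l r')`. -/
def PairAlgebra (K : Type*) [Field K] (Y Z : Type*) : Type _ :=
  (TensorMonomial Y Z →₀ K) × (TensorMonomial Y Z →₀ K)

noncomputable instance : AddCommGroup (PairAlgebra K Y Z) :=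
  inferInstanceAs (AddCommGroup ((TensorMonomial Y Z →₀ K) ×
    (TensorMonomial Y Z →₀ K)))

noncomputable instance : Module K (PairAlgebra K Y Z) :=
  inferInstanceAs (Module K ((TensorMonomial Y Z →₀ K) ×
    (TensorMonomial Y Z →₀ K)))

namespace PairAlgebra

@[ext] theorem ext {a b : PairAlgebra K Y Z} (h : a.1 = b.1) (h' : a.2 = b.2) : a = b :=
  Prod.ext h h'

theorem add_fst (a b : PairAlgebra K Y Z) : (a + b).1 = a.1 + b.1 := rfl

theorem add_snd (a b : PairAlgebra K Y Z) : (a + b).2 = a.2 + b.2 := rfl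

theorem smul_fst (c : K) (a : PairAlgebra K Y Z) : (c • a).1 = c • a.1 := rfl

theorem smul_snd (c : K) (a : PairAlgebra K Y Z) : (c • a).2 = c • a.2 := rfl

theorem zero_fst : (0 : PairAlgebra K Y Z).1 = 0 := rfl

theorem zero_snd : (0 : PairAlgebra K Y Z).2 = 0 := rfl

end PairAlgebra

variable [DecidableEq Y] [LinearOrder Z]

/-- Both components are squarefree in the odd letters. -/
def BiAdmissible (d : TensorMonomial Y Z) : Prop :=
  Admissible d.1 ∧ Admissible d.2

theorem BiAdmissible.of_add_left {d d' : TensorMonomial Y Z}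
    (h : BiAdmissible (d + d')) : BiAdmissible d :=
  ⟨Admissible.of_add_left h.1, Admissible.of_add_left h.2⟩

theorem BiAdmissible.of_add_right {d d' : TensorMonomial Y Z}
    (h : BiAdmissible (d + d')) : BiAdmissible d' :=
  ⟨Admissible.of_add_right h.1, Admissible.of_add_right h.2⟩

variable [Fintype Z]

/-- The number of odd letters modulo two. -/
def parity (m : Multiset (Y ⊕ Z)) : ZMod 2 := ∑ z : Z, (m.count (Sum.inr z) : ZMod 2)

theorem parity_add (m m' : Multiset (Y ⊕ Z)) : parity (m + m') = parity m + parity m' := by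
  simp [parity, Finset.sum_add_distrib]

/-- The number modulo two of transpositions of odd letters needed to sort the product of the sorted
words with letters `m` and `m'`. -/
def inversions (m m' : Multiset (Y ⊕ Z)) : ZMod 2 :=
  ∑ z : Z, ∑ z' : Z,
    if z' < z then (m.count (Sum.inr z) : ZMod 2) * (m'.count (Sum.inr z') : ZMod 2) else 0

theorem inversions_add_left (m m' n : Multiset (Y ⊕ Z)) :
    inversions (m + m') n = inversions m n + inversions m' n := by
  simp only [inversions, ← Finset.sum_add_distrib]
  refine Finset.sum_congr rfl fun z _ => Finset.sum_congr rfl fun z' _ => ?_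
  split_ifs
  · rw [Multiset.count_add, Nat.cast_add, add_mul]
  · rw [add_zero]

theorem inversions_add_right (n m m' : Multiset (Y ⊕ Z)) :
    inversions n (m + m') = inversions n m + inversions n m' := by
  simp only [inversions, ← Finset.sum_add_distrib]
  refine Finset.sum_congr rfl fun z _ => Finset.sum_congr rfl fun z' _ => ?_
  split_ifs
  · rw [Multiset.count_add, Nat.cast_add, mul_add]
  · rw [add_zero]

/-- Each pair of distinct odd letters is inverted in exactly one of the two orders. -/
theorem inversions_add_swap {m m' : Multiset (Y ⊕ Z)} (h : Admissible (m + m')) :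
    inversions m m' + inversions m' m = parity m * parity m' := by
  rw [inversions, inversions, parity, parity, Finset.sum_mul_sum]
  nth_rewrite 2 [Finset.sum_comm]
  simp only [← Finset.sum_add_distrib]
  refine Finset.sum_congr rfl fun z _ => Finset.sum_congr rfl fun z' _ => ?_
  obtain hz | rfl | hz := lt_trichotomy z z'
  · rw [if_neg hz.asymm, if_pos hz, zero_add, mul_comm]
  · -- a letter cannot occur in both factors of an admissible product
    have hz := h z
    rw [Multiset.count_add] at hz
    have h0 : m.count (Sum.inr z) = 0 ∨ m'.count (Sum.inr z) = 0 := by omega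
    obtain h0 | h0 := h0 <;> simp [h0]
  · rw [if_pos hz, if_neg hz.asymm, add_zero]

/-- The exponent of the sign in the product of two monomials of the super tensor square of the free
supercommutative algebra: moving `d'.1` past `d.2` and sorting both tensor factors. -/
def twist (d d' : TensorMonomial Y Z) : ZMod 2 :=
  inversions d.1 d'.1 + parity d.2 * parity d'.1 + inversions d.2 d'.2

theorem twist_add_left (d d' e : TensorMonomial Y Z) :
    twist (d + d') e = twist d e + twist d' e := by
  simp only [twist, Prod.fst_add, Prod.snd_add, inversions_add_left, parity_add]
  ring

theorem twist_add_right (e d d' : TensorMonomial Y Z) :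
    twist e (d + d') = twist e d + twist e d' := by
  simp only [twist, Prod.fst_add, Prod.snd_add, inversions_add_right, parity_add]
  ring

/-- The parity of a monomial of the super tensor square. -/
def biParity (d : TensorMonomial Y Z) : ZMod 2 := parity d.1 + parity d.2

theorem biParity_add (d d' : TensorMonomial Y Z) :
    biParity (d + d') = biParity d + biParity d' := by
  simp only [biParity, Prod.fst_add, Prod.snd_add, parity_add]
  ring

theorem twist_swap {d d' : TensorMonomial Y Z} (h : BiAdmissible (d + d')) :
    twist d d' = biParity d * biParity d' + twist d' d := by
  have h1 := inversions_add_swap h.1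
  have h2 := inversions_add_swap h.2
  have h3 : ∀ a : ZMod 2, a + a = 0 := by decide
  simp only [twist, biParity]
  linear_combination h1 + h2 - h3 (inversions d'.1 d.1) - h3 (inversions d'.2 d.2) -
    h3 (parity d'.2 * parity d.1)

variable (K)

open Classical in
/-- The structure constants of the twisted monomial algebra. -/
noncomputable def structConst (d d' : TensorMonomial Y Z) : K :=
  if BiAdmissible (d + d') then sign K (twist d d') else 0

theorem structConst_ne_zero {d d' : TensorMonomial Y Z}
    (h : BiAdmissible (d + d')) : structConst K d d' ≠ 0 := by
  rw [structConst, if_pos h]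
  exact sign_ne_zero K _

/-- The twist is biadditive, hence a two-cocycle. -/
theorem structConst_assoc (d e f : TensorMonomial Y Z) :
    structConst K d e * structConst K (d + e) f = structConst K e f * structConst K d (e + f) := by
  by_cases h : BiAdmissible (d + e + f)
  · have h' : BiAdmissible (d + (e + f)) := by rwa [← add_assoc]
    rw [structConst, structConst, structConst, structConst, if_pos h, if_pos h', if_pos h.of_add_left,
      if_pos h'.of_add_right, twist_add_left, twist_add_right, sign_add, sign_add]
    ring
  · have h' : ¬ BiAdmissible (d + (e + f)) := by rwa [← add_assoc]
    rw [structConst, structConst, structConst, structConst, if_neg h, if_neg h', mul_zero, mul_zero]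

theorem structConst_comm (d e : TensorMonomial Y Z) :
    structConst K d e = sgn K (biParity d) (biParity e) * structConst K e d := by
  rw [structConst, structConst, add_comm e d]
  split_ifs with h
  · rw [twist_swap h, sign_add, sgn_eq_sign]
  · rw [mul_zero]

variable (Y Z)

/-- The multiplication of the super tensor square of the free supercommutative algebra, in the
monomial basis. -/
noncomputable def tensorMul :
    (TensorMonomial Y Z →₀ K) →ₗ[K]
      (TensorMonomial Y Z →₀ K) →ₗ[K]
        (TensorMonomial Y Z →₀ K) :=
  Finsupp.linearCombination K fun d => Finsupp.linearCombination K fun e =>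
    Finsupp.single (d + e) (structConst K d e)

variable {Y Z}

theorem tensorMul_single (d e : TensorMonomial Y Z) (a b : K) :
    tensorMul K Y Z (Finsupp.single d a) (Finsupp.single e b) =
      Finsupp.single (d + e) (a * b * structConst K d e) := by
  rw [tensorMul, Finsupp.linearCombination_single, LinearMap.smul_apply,
    Finsupp.linearCombination_single, Finsupp.smul_single, Finsupp.smul_single, smul_eq_mul,
    smul_eq_mul, mul_assoc]

theorem tensorMul_assoc (a b c : TensorMonomial Y Z →₀ K) :
    tensorMul K Y Z (tensorMul K Y Z a b) c = tensorMul K Y Z a (tensorMul K Y Z b c) := by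
  induction a using Finsupp.induction_linear with
  | zero => simp
  | add a a' ha ha' => simp only [map_add, LinearMap.add_apply, ha, ha']
  | single d r => ?_
  induction b using Finsupp.induction_linear with
  | zero => simp
  | add a a' ha ha' => simp only [map_add, LinearMap.add_apply, ha, ha']
  | single e s => ?_
  induction c using Finsupp.induction_linear with
  | zero => simp
  | add a a' ha ha' => simp only [map_add, ha, ha']
  | single f t => ?_
  simp only [tensorMul_single]
  rw [add_assoc]
  congr 1
  linear_combination (r * s * t) * structConst_assoc K d e f

variable (Y Z) in
/-- The homogeneous components of the super tensor square. -/
def tensorComponent (i : ZMod 2) : Submodule K (TensorMonomial Y Z →₀ K) :=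
  Finsupp.supported K K {d | biParity d = i}

theorem single_mem_tensorComponent (d : TensorMonomial Y Z) (a : K) :
    Finsupp.single d a ∈ tensorComponent K Y Z (biParity d) :=
  Finsupp.single_mem_supported K a rfl

variable {K}

theorem tensorComponent_induction {i : ZMod 2}
    {p : (TensorMonomial Y Z →₀ K) → Prop}
    (zero : p 0) (add : ∀ a b, p a → p b → p (a + b))
    (single : ∀ d r, biParity d = i → p (Finsupp.single d r))
    {a : TensorMonomial Y Z →₀ K} (ha : a ∈ tensorComponent K Y Z i) : p a := by
  rw [← Finsupp.sum_single a]
  exact Finset.sum_induction _ p add zero fun d hd =>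
    single d (a d) ((Finsupp.mem_supported K a).1 ha hd)

theorem tensorMul_mem {i j : ZMod 2} {a b : TensorMonomial Y Z →₀ K}
    (ha : a ∈ tensorComponent K Y Z i) (hb : b ∈ tensorComponent K Y Z j) :
    tensorMul K Y Z a b ∈ tensorComponent K Y Z (i + j) := by
  refine tensorComponent_induction (p := fun a => tensorMul K Y Z a b ∈ _) ?_ ?_ ?_ ha
  · simp
  · intro a a' h h'
    rw [map_add, LinearMap.add_apply]
    exact add_mem h h'
  rintro d r rfl
  refine tensorComponent_induction (p := fun b => tensorMul K Y Z _ b ∈ _) ?_ ?_ ?_ hb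
  · simp
  · intro a a' h h'
    rw [map_add]
    exact add_mem h h'
  rintro e s rfl
  rw [tensorMul_single, ← biParity_add]
  exact single_mem_tensorComponent K _ _

theorem tensorMul_comm {i j : ZMod 2} {a b : TensorMonomial Y Z →₀ K}
    (ha : a ∈ tensorComponent K Y Z i) (hb : b ∈ tensorComponent K Y Z j) :
    tensorMul K Y Z a b = sgn K i j • tensorMul K Y Z b a := by
  refine tensorComponent_induction
    (p := fun a => tensorMul K Y Z a b = sgn K i j • tensorMul K Y Z b a) ?_ ?_ ?_ ha
  · simp
  · intro a a' h h'
    rw [map_add, LinearMap.add_apply, h, h', map_add, smul_add]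
  rintro d r rfl
  refine tensorComponent_induction (p := fun b => tensorMul K Y Z _ b = _ • tensorMul K Y Z b _)
    ?_ ?_ ?_ hb
  · simp
  · intro a a' h h'
    rw [map_add, LinearMap.map_add₂, h, h', smul_add]
  rintro e s rfl
  rw [tensorMul_single, tensorMul_single, Finsupp.smul_single, add_comm e d, smul_eq_mul]
  congr 1
  linear_combination (r * s) * structConst_comm K d e

variable (K) (Y) (Z)

/-! ### A bicommutative superalgebra of pairs -/

noncomputable instance : Mul (PairAlgebra K Y Z) :=
  ⟨fun a b => (tensorMul K Y Z a.1 b.2, tensorMul K Y Z a.1 b.2)⟩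

variable {K Y Z}

namespace PairAlgebra

theorem mul_fst (a b : PairAlgebra K Y Z) : (a * b).1 = tensorMul K Y Z a.1 b.2 := rfl

theorem mul_snd (a b : PairAlgebra K Y Z) : (a * b).2 = tensorMul K Y Z a.1 b.2 := rfl

end PairAlgebra

open PairAlgebra

noncomputable instance : NonUnitalNonAssocRing (PairAlgebra K Y Z) :=
  { (inferInstance : AddCommGroup (PairAlgebra K Y Z)),
    (inferInstance : Mul (PairAlgebra K Y Z)) with
    left_distrib := fun a b c => by
      ext1 <;> simp only [mul_fst, mul_snd, add_fst, add_snd, map_add]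
    right_distrib := fun a b c => by
      ext1 <;> simp only [mul_fst, mul_snd, add_fst, add_snd, map_add, LinearMap.add_apply]
    zero_mul := fun a => by
      ext1 <;> simp only [mul_fst, mul_snd, zero_fst, zero_snd, map_zero, LinearMap.zero_apply]
    mul_zero := fun a => by
      ext1 <;> simp only [mul_fst, mul_snd, zero_fst, zero_snd, map_zero] }

instance : IsScalarTower K (PairAlgebra K Y Z) (PairAlgebra K Y Z) :=
  ⟨fun c a b => by
    simp only [smul_eq_mul]
    ext1 <;> simp only [mul_fst, mul_snd, smul_fst, smul_snd, map_smul, LinearMap.smul_apply]⟩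

instance : SMulCommClass K (PairAlgebra K Y Z) (PairAlgebra K Y Z) :=
  ⟨fun c a b => by
    simp only [smul_eq_mul]
    ext1 <;> simp only [mul_fst, mul_snd, smul_fst, smul_snd, map_smul]⟩

variable (K Y Z) in
/-- The homogeneous components of the algebra of pairs. -/
noncomputable def pairComponent (i : ZMod 2) : Submodule K (PairAlgebra K Y Z) :=
  (tensorComponent K Y Z i).prod (tensorComponent K Y Z i)

theorem pairComponent_mul {i j : ZMod 2} {a b : PairAlgebra K Y Z}
    (ha : a ∈ pairComponent K Y Z i) (hb : b ∈ pairComponent K Y Z j) :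
    a * b ∈ pairComponent K Y Z (i + j) :=
  ⟨tensorMul_mem ha.1 hb.2, tensorMul_mem ha.1 hb.2⟩

theorem pair_left_comm {i j : ZMod 2} {a b : PairAlgebra K Y Z}
    (ha : a ∈ pairComponent K Y Z i) (hb : b ∈ pairComponent K Y Z j) (c : PairAlgebra K Y Z) :
    a * (b * c) = sgn K i j • (b * (a * c)) := by
  have h : tensorMul K Y Z a.1 (tensorMul K Y Z b.1 c.2) =
      sgn K i j • tensorMul K Y Z b.1 (tensorMul K Y Z a.1 c.2) := by
    rw [← tensorMul_assoc, tensorMul_comm ha.1 hb.1, map_smul, LinearMap.smul_apply,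
      tensorMul_assoc]
  exact PairAlgebra.ext h h

theorem pair_right_comm {j k : ZMod 2} (a : PairAlgebra K Y Z) {b c : PairAlgebra K Y Z}
    (hb : b ∈ pairComponent K Y Z j) (hc : c ∈ pairComponent K Y Z k) :
    a * b * c = sgn K j k • (a * c * b) := by
  have h : tensorMul K Y Z (tensorMul K Y Z a.1 b.2) c.2 =
      sgn K j k • tensorMul K Y Z (tensorMul K Y Z a.1 c.2) b.2 := by
    rw [tensorMul_assoc, tensorMul_comm hb.2 hc.2, map_smul, tensorMul_assoc]
  exact PairAlgebra.ext h h

variable (K) in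
/-- The image of a generator: the letter in the left and in the right tensor factor. -/
noncomputable def pairGen (x : Y ⊕ Z) : PairAlgebra K Y Z :=
  (Finsupp.single ({x}, 0) 1, Finsupp.single (0, {x}) 1)

theorem parity_zero : parity (0 : Multiset (Y ⊕ Z)) = 0 := by simp [parity]

theorem parity_singleton (x : Y ⊕ Z) : parity {x} = parityWeight Y Z x := by
  rcases x with y | z
  · simp [parity, parityWeight]
  · simp [parity, parityWeight, Multiset.count_singleton]

theorem pairGen_mem (x : Y ⊕ Z) : pairGen K x ∈ pairComponent K Y Z (parityWeight Y Z x) := by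
  constructor
  · have := single_mem_tensorComponent K (({x}, 0) : TensorMonomial Y Z) 1
    rwa [biParity, parity_zero, parity_singleton, add_zero] at this
  · have := single_mem_tensorComponent K ((0, {x}) : TensorMonomial Y Z) 1
    rwa [biParity, parity_zero, parity_singleton, zero_add] at this

variable (K Y Z) in
/-- The homomorphism from the free bicommutative superalgebra to the algebra of pairs. -/
noncomputable def toPair : Free K Y Z →ₙₐ[K] PairAlgebra K Y Z :=
  descend (FreeNonUnitalNonAssocAlgebra.lift K (pairGen K)) (by
    have hl : ∀ {i a}, a ∈ absComponent K (parityWeight Y Z) i →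
        FreeNonUnitalNonAssocAlgebra.lift K (pairGen K) a ∈ pairComponent K Y Z i := fun ha =>
      lift_mem (parityWeight Y Z) (pairComponent K Y Z) pairComponent_mul _
        (fun x => by rw [FreeNonUnitalNonAssocAlgebra.lift_of_apply]; exact pairGen_mem x) ha
    rintro _ (⟨hx, hy, -⟩ | ⟨-, hy, hz⟩)
    · simp only [map_sub, map_smul, map_mul]
      rw [pair_left_comm (hl hx) (hl hy), sub_self]
    · simp only [map_sub, map_smul, map_mul]
      rw [pair_right_comm _ (hl hy) (hl hz), sub_self])

theorem toPair_of (x : Y ⊕ Z) : toPair K Y Z (mon K (FreeMagma.of x)) = pairGen K x :=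
  FreeNonUnitalNonAssocAlgebra.lift_of_apply (R := K) _ x

theorem toPair_mulLeftList (l : List (Y ⊕ Z)) (y : Y ⊕ Z)
    (hl : Admissible (l : Multiset (Y ⊕ Z))) :
    ∃ c : K, c ≠ 0 ∧ (toPair K Y Z (mon K (mulLeftList l (FreeMagma.of y)))).2 =
      Finsupp.single ((l : Multiset (Y ⊕ Z)), {y}) c := by
  induction l with
  | nil => exact ⟨1, one_ne_zero, by rw [mulLeftList_nil, toPair_of]; rfl⟩
  | cons x l ih =>
    rw [← Multiset.cons_coe, ← Multiset.singleton_add] at hl ⊢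
    obtain ⟨c, hc, h⟩ := ih hl.of_add_right
    refine ⟨1 * c * structConst K ({x}, 0) ((l : Multiset (Y ⊕ Z)), {y}), ?_, ?_⟩
    rotate_left
    · rw [mulLeftList_cons, mon_mul, map_mul, mul_snd, h, toPair_of]
      change tensorMul K Y Z (Finsupp.single _ 1) _ = _
      rw [tensorMul_single, Prod.mk_add_mk, zero_add]
    · rw [one_mul]
      refine mul_ne_zero hc (structConst_ne_zero K ?_)
      rw [Prod.mk_add_mk, zero_add]
      exact ⟨hl, admissible_singleton y⟩

/-- The image of an admissible word is a nonzero multiple of the monomial whose tensor factors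
are the left and the right letters of the word. -/
theorem toPair_word {l : List (Y ⊕ Z)} (hl0 : l ≠ []) (y : Y ⊕ Z) (r : List (Y ⊕ Z))
    (hl : Admissible (l : Multiset (Y ⊕ Z)))
    (hr : Admissible ((y :: r : List (Y ⊕ Z)) : Multiset (Y ⊕ Z))) :
    ∃ c : K, c ≠ 0 ∧ (toPair K Y Z (mon K (word l y r))).1 =
      Finsupp.single ((l : Multiset (Y ⊕ Z)), ((y :: r : List (Y ⊕ Z)) : Multiset (Y ⊕ Z))) c := by
  induction r using List.reverseRecOn with
  | nil =>
    obtain ⟨c, hc, h⟩ := toPair_mulLeftList (K := K) l y hl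
    refine ⟨c, hc, ?_⟩
    rw [word, mulRightList_nil]
    obtain ⟨a, b, hab⟩ := exists_mulLeftList_eq_mul (FreeMagma.of y) hl0
    rw [hab, mon_mul, map_mul] at h ⊢
    exact h
  | append_singleton r x ih =>
    have hrx : ((y :: (r ++ [x]) : List (Y ⊕ Z)) : Multiset (Y ⊕ Z)) =
        ((y :: r : List (Y ⊕ Z)) : Multiset (Y ⊕ Z)) + {x} := by
      rw [← List.cons_append, ← Multiset.coe_add, Multiset.coe_singleton]
    rw [hrx] at hr ⊢
    obtain ⟨c, hc, h⟩ := ih hr.of_add_left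
    refine ⟨c * 1 * structConst K
      ((l : Multiset (Y ⊕ Z)), ((y :: r : List (Y ⊕ Z)) : Multiset (Y ⊕ Z))) (0, {x}), ?_, ?_⟩
    rotate_left
    · rw [word, mulRightList_concat, mon_mul, map_mul, mul_fst, toPair_of]
      rw [word] at h
      rw [h]
      change tensorMul K Y Z _ (Finsupp.single _ 1) = _
      rw [tensorMul_single, Prod.mk_add_mk, add_zero]
    · rw [mul_one]
      refine mul_ne_zero hc (structConst_ne_zero K ?_)
      rw [Prod.mk_add_mk, add_zero]
      exact ⟨hl, hr⟩

end Model


/-! ### A homogeneous basis -/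

section Basis

variable {K : Type*} [Field K] {Y Z : Type*} [DecidableEq Y] [LinearOrder Z]

variable (Y Z) in
/-- The nonempty multisets of letters that are squarefree in the odd letters. -/
abbrev NonzeroMonomial : Type _ := {m : Multiset (Y ⊕ Z) // Admissible m ∧ m ≠ 0}

variable (Y Z) in
/-- The index type of a basis of the free bicommutative superalgebra: the generators, and the pairs
of nonempty admissible multisets of left and right letters. -/
abbrev BasisIndex : Type _ := (Y ⊕ Z) ⊕ (NonzeroMonomial Y Z × NonzeroMonomial Y Z)

/-- The weight of a commutative monomial. -/
def weight {X M : Type*} [AddCommMonoid M] (w : X → M) (m : Multiset X) : M := (m.map w).sum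

/-- The weight of a basis element. -/
def indexWeight {M : Type*} [AddCommMonoid M] (w : Y ⊕ Z → M) : BasisIndex Y Z → M :=
  Sum.elim w fun s => weight w s.1.1 + weight w s.2.1

theorem exists_lists_of_nonzeroMonomial (s : NonzeroMonomial Y Z × NonzeroMonomial Y Z) :
    ∃ (l : List (Y ⊕ Z)) (y : Y ⊕ Z) (r : List (Y ⊕ Z)), l ≠ [] ∧ (l : Multiset (Y ⊕ Z)) = s.1.1 ∧
      ((y :: r : List (Y ⊕ Z)) : Multiset (Y ⊕ Z)) = s.2.1 := by
  obtain ⟨⟨m, -, hm⟩, ⟨n, -, hn⟩⟩ := s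
  induction m using Quotient.inductionOn with | _ l
  induction n using Quotient.inductionOn with | _ r
  cases r with
  | nil => exact absurd rfl hn
  | cons y r => exact ⟨l, y, r, fun h => hm (by rw [h]; rfl), rfl, rfl⟩

/-- The monomial of the super tensor square to which a basis element is mapped, up to a scalar. -/
def indexMonomial : BasisIndex Y Z → TensorMonomial Y Z :=
  Sum.elim (fun x => ({x}, 0)) fun s => (s.1.1, s.2.1)

theorem indexMonomial_injective : Function.Injective (indexMonomial (Y := Y) (Z := Z)) := by
  rintro (x | ⟨⟨m, hm⟩, ⟨n, hn⟩⟩) (x' | ⟨⟨m', hm'⟩, ⟨n', hn'⟩⟩) h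
  · simpa [indexMonomial] using h
  · exact absurd (Prod.ext_iff.1 h).2.symm hn'.2
  · exact absurd (Prod.ext_iff.1 h).2 hn.2
  · obtain ⟨rfl, rfl⟩ := Prod.ext_iff.1 h
    rfl

variable [Fintype Z]

variable (K Y Z) in
/-- The first component of the homomorphism to the algebra of pairs. -/
noncomputable def toTensor : Free K Y Z →ₗ[K] (TensorMonomial Y Z →₀ K) :=
  { toFun := fun a => (toPair K Y Z a).1
    map_add' := fun a b => by rw [map_add]; rfl
    map_smul' := fun c a => by rw [map_smul]; rfl }

/-- The dimension of a component, for an arbitrary grading of the generators, is the number of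
basis elements of that weight. -/
theorem finrank_component (hK : ringChar K ≠ 2) {M : Type*} [AddCommMonoid M] (w : Y ⊕ Z → M)
    (c : M) : Module.finrank K (component K w c) =
      Nat.card {i : BasisIndex Y Z // indexWeight w i = c} := by
  choose l y r hl hm hn using exists_lists_of_nonzeroMonomial (Y := Y) (Z := Z)
  let t : BasisIndex Y Z → FreeMagma (Y ⊕ Z) :=
    Sum.elim FreeMagma.of fun s => word (l s) (y s) (r s)
  have hwt : ∀ i, wt w (t i) = indexWeight w i := by
    rintro (x | s)
    · rfl
    · change wt w (word (l s) (y s) (r s)) = weight w s.1.1 + weight w s.2.1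
      rw [wt_eq_sum_content, content_word, hm, hn, Multiset.map_add, Multiset.sum_add]
      rfl
  have himage : ∀ i, ∃ a : Kˣ, toTensor K Y Z (mon K (t i)) =
      a • Finsupp.single (indexMonomial i) (1 : K) := by
    rintro (x | s)
    · refine ⟨1, ?_⟩
      rw [one_smul]
      exact congrArg Prod.fst (toPair_of (K := K) x)
    · obtain ⟨a, ha, h⟩ := toPair_word (K := K) (hl s) (y s) (r s)
        (by rw [hm]; exact s.1.2.1) (by rw [hn]; exact s.2.2.1)
      refine ⟨Units.mk0 a ha, ?_⟩
      rw [hm, hn] at h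
      rw [Units.smul_def, Units.val_mk0, Finsupp.smul_single, smul_eq_mul, mul_one]
      exact h
  choose a ha using himage
  have hindep : LinearIndependent K fun i => mon K (t i) := by
    refine LinearIndependent.of_comp (toTensor K Y Z) ?_
    have := ((Finsupp.basisSingleOne (R := K) (ι := TensorMonomial Y Z)).linearIndependent.comp _
      indexMonomial_injective).units_smul a
    convert this using 1
    ext1 i
    simpa using ha i
  have hspan : component K w c = Submodule.span K
      (Set.range fun i : {i : BasisIndex Y Z // indexWeight w i = c} => mon K (t i)) := by
    rw [component, absComponent, Submodule.map_span]
    refine le_antisymm (Submodule.span_le.2 ?_) (Submodule.span_le.2 ?_)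
    · rintro _ ⟨_, ⟨u, hu, rfl⟩, rfl⟩
      change wt w u = c at hu
      change mon K u ∈ Submodule.span K _
      obtain ⟨x, rfl⟩ | ⟨l', y', r', hl', h⟩ := eq_of_or_hasNormalForm (K := K) u
      · exact Submodule.subset_span ⟨⟨Sum.inl x, hu⟩, rfl⟩
      · by_cases hadm : Admissible (l' : Multiset (Y ⊕ Z)) ∧
            Admissible ((y' :: r' : List (Y ⊕ Z)) : Multiset (Y ⊕ Z))
        · let s : NonzeroMonomial Y Z × NonzeroMonomial Y Z :=
            (⟨l', hadm.1, by simpa using hl'⟩, ⟨(y' :: r' : List (Y ⊕ Z)), hadm.2, by simp⟩)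
          obtain ⟨hcontent, b, -, hb⟩ := h.trans (similar_word_of_perm hl'
            (Multiset.coe_eq_coe.1 (hm s).symm) (Multiset.coe_eq_coe.1 (hn s).symm))
          rw [hb]
          refine Submodule.smul_mem _ _ (Submodule.subset_span ⟨⟨Sum.inr s, ?_⟩, rfl⟩)
          rw [← hwt, ← hu, wt_eq_sum_content, wt_eq_sum_content, hcontent]
          rfl
        · rw [h.mon_eq_zero (mon_word_eq_zero hK hl' hadm)]
          exact zero_mem _
    · rintro _ ⟨⟨i, hi⟩, rfl⟩
      exact Submodule.subset_span ⟨_, ⟨t i, (hwt i).trans hi, rfl⟩, rfl⟩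
  have hsub : LinearIndependent K
      fun i : {i : BasisIndex Y Z // indexWeight w i = c} => mon K (t i) :=
    hindep.comp _ Subtype.val_injective
  rw [hspan, Module.finrank, rank_span hsub]
  exact Nat.card_congr (Equiv.ofInjective _ hsub.injective).symm

end Basis


/-! ### Generating functions of weighted index types -/

section GenFun

variable {σ ι κ : Type*}

/-- The generating function of the number of elements of given degree. -/
noncomputable def genFun (deg : ι → σ →₀ ℕ) : MvPowerSeries σ ℚ :=
  fun d => (Nat.card {i // deg i = d} : ℚ)

/-- There are finitely many elements of each degree. -/
def FiniteFibers (deg : ι → σ →₀ ℕ) : Prop := ∀ d, Finite {i // deg i = d}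

theorem coeff_genFun (deg : ι → σ →₀ ℕ) (d : σ →₀ ℕ) :
    MvPowerSeries.coeff d (genFun deg) = (Nat.card {i // deg i = d} : ℚ) := rfl

theorem FiniteFibers.comp_injective {deg : κ → σ →₀ ℕ} (h : FiniteFibers deg) {e : ι → κ}
    (he : Function.Injective e) : FiniteFibers (deg ∘ e) := fun d =>
  have := h d
  Finite.of_injective (fun i : {i // (deg ∘ e) i = d} => (⟨e i, i.2⟩ : {i // deg i = d}))
    fun _ _ hij => Subtype.ext (he (congrArg Subtype.val hij))

theorem finiteFibers_of_injective {deg : ι → σ →₀ ℕ} (h : Function.Injective deg) :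
    FiniteFibers deg := fun d =>
  have : Subsingleton {i // deg i = d} := ⟨fun i j => Subtype.ext (h (i.2.trans j.2.symm))⟩
  Finite.of_subsingleton

theorem finiteFibers_of_finite [Finite ι] (deg : ι → σ →₀ ℕ) : FiniteFibers deg := fun _ =>
  inferInstance

theorem genFun_comp_equiv (e : ι ≃ κ) (deg : κ → σ →₀ ℕ) : genFun (deg ∘ e) = genFun deg := by
  ext d
  rw [coeff_genFun, coeff_genFun]
  exact congrArg Nat.cast (Nat.card_congr
    (e.subtypeEquiv (p := fun i => (deg ∘ e) i = d) (q := fun i => deg i = d) fun _ => Iff.rfl))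

theorem genFun_sum {f : ι → σ →₀ ℕ} {g : κ → σ →₀ ℕ} (hf : FiniteFibers f)
    (hg : FiniteFibers g) : genFun (Sum.elim f g) = genFun f + genFun g := by
  ext d
  have : Finite {i // Sum.elim f g (Sum.inl i) = d} := hf d
  have : Finite {i // Sum.elim f g (Sum.inr i) = d} := hg d
  rw [map_add, coeff_genFun, coeff_genFun, coeff_genFun, Nat.card_congr Equiv.subtypeSum,
    Nat.card_sum]
  push_cast
  rfl

theorem genFun_fintype [Fintype ι] (deg : ι → σ →₀ ℕ) :
    genFun deg = ∑ i, MvPowerSeries.monomial (deg i) 1 := by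
  classical
  ext d
  rw [coeff_genFun, map_sum, Nat.card_eq_fintype_card, Fintype.card_subtype, Finset.card_filter]
  push_cast
  refine Finset.sum_congr rfl fun i _ => ?_
  rw [MvPowerSeries.coeff_monomial]
  simp only [eq_comm]

/-- The elements of a product of degree `d`, sorted by the degrees of their components. -/
theorem nonempty_fiber_prod_equiv [DecidableEq σ] (f : ι → σ →₀ ℕ) (g : κ → σ →₀ ℕ)
    (d : σ →₀ ℕ) :
    Nonempty ({i : ι × κ // f i.1 + g i.2 = d} ≃
      Σ a : Finset.HasAntidiagonal.antidiagonal d, {i // f i = a.1.1} × {i // g i = a.1.2}) :=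
  ⟨{ toFun := fun i => ⟨⟨(f i.1.1, g i.1.2), Finset.HasAntidiagonal.mem_antidiagonal.2 i.2⟩,
      ⟨i.1.1, rfl⟩, ⟨i.1.2, rfl⟩⟩
     invFun := fun s => ⟨(s.2.1.1, s.2.2.1), by
      rw [s.2.1.2, s.2.2.2]; exact Finset.HasAntidiagonal.mem_antidiagonal.1 s.1.2⟩
     left_inv := fun _ => rfl
     right_inv := by
      rintro ⟨⟨⟨a, b⟩, hab⟩, ⟨i, hi⟩, ⟨j, hj⟩⟩
      change f i = a at hi
      change g j = b at hj
      subst hi hj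
      rfl }⟩

theorem FiniteFibers.prod {f : ι → σ →₀ ℕ} {g : κ → σ →₀ ℕ} (hf : FiniteFibers f)
    (hg : FiniteFibers g) : FiniteFibers fun i : ι × κ => f i.1 + g i.2 := by
  classical
  intro d
  obtain ⟨e⟩ := nonempty_fiber_prod_equiv f g d
  have := fun d => hf d
  have := fun d => hg d
  exact Finite.of_equiv _ e.symm

theorem genFun_prod {f : ι → σ →₀ ℕ} {g : κ → σ →₀ ℕ} (hf : FiniteFibers f)
    (hg : FiniteFibers g) :
    genFun (fun i : ι × κ => f i.1 + g i.2) = genFun f * genFun g := by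
  classical
  ext d
  obtain ⟨e⟩ := nonempty_fiber_prod_equiv f g d
  have := fun d => hf d
  have := fun d => hg d
  rw [MvPowerSeries.coeff_mul, coeff_genFun, Nat.card_congr e, Nat.card_sigma,
    Nat.cast_sum]
  simp only [Nat.card_prod, Nat.cast_mul, coeff_genFun]
  exact Finset.sum_coe_sort _ fun p : (σ →₀ ℕ) × (σ →₀ ℕ) =>
    (Nat.card {i // f i = p.1} : ℚ) * (Nat.card {i // g i = p.2} : ℚ)

/-- The families of total degree `d`, sorted by the degrees of their members. -/
theorem nonempty_fiber_pi_equiv [DecidableEq σ] {X : Type*} [Fintype X] [DecidableEq X]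
    {α : X → Type*} (f : ∀ x, α x → σ →₀ ℕ) (d : σ →₀ ℕ) :
    Nonempty ({i : ∀ x, α x // ∑ x, f x (i x) = d} ≃
      Σ l : Finset.finsuppAntidiag (Finset.univ : Finset X) d, ∀ x, {i // f x i = l.1 x}) :=
  ⟨{ toFun := fun i => ⟨⟨Finsupp.equivFunOnFinite.symm fun x => f x (i.1 x),
      Finset.mem_finsuppAntidiag.2 ⟨i.2, Finset.subset_univ _⟩⟩, fun x => ⟨i.1 x, rfl⟩⟩
     invFun := fun s => ⟨fun x => (s.2 x).1, by
      simp only [fun x => (s.2 x).2]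
      exact (Finset.mem_finsuppAntidiag.1 s.1.2).1⟩
     left_inv := fun _ => rfl
     right_inv := by
      rintro ⟨⟨l, hl⟩, i⟩
      have h : l = Finsupp.equivFunOnFinite.symm fun x => f x (i x).1 := by
        ext1 x
        exact (i x).2.symm
      have hfst : (⟨Finsupp.equivFunOnFinite.symm fun x => f x (i x).1, h ▸ hl⟩ :
          Finset.finsuppAntidiag (Finset.univ : Finset X) d) = ⟨l, hl⟩ := Subtype.ext h.symm
      refine Sigma.ext hfst (Function.hfunext rfl ?_)
      rintro x _ ⟨⟩
      refine (Subtype.heq_iff_coe_eq fun a => ?_).2 rfl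
      change f x a = f x (i x).1 ↔ f x a = l x
      rw [(i x).2] }⟩

theorem FiniteFibers.pi {X : Type*} [Fintype X] {α : X → Type*} {f : ∀ x, α x → σ →₀ ℕ}
    (hf : ∀ x, FiniteFibers (f x)) : FiniteFibers fun i : ∀ x, α x => ∑ x, f x (i x) := by
  classical
  intro d
  obtain ⟨e⟩ := nonempty_fiber_pi_equiv f d
  have := fun x d => hf x d
  exact Finite.of_equiv _ e.symm

theorem genFun_pi {X : Type*} [Fintype X] {α : X → Type*} {f : ∀ x, α x → σ →₀ ℕ}
    (hf : ∀ x, FiniteFibers (f x)) :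
    genFun (fun i : ∀ x, α x => ∑ x, f x (i x)) = ∏ x, genFun (f x) := by
  classical
  ext d
  obtain ⟨e⟩ := nonempty_fiber_pi_equiv f d
  have := fun x d => hf x d
  rw [MvPowerSeries.coeff_prod, coeff_genFun, Nat.card_congr e, Nat.card_sigma,
    Nat.cast_sum]
  simp only [Nat.card_pi, Nat.cast_prod, coeff_genFun]
  exact Finset.sum_coe_sort _ fun l : X →₀ (σ →₀ ℕ) =>
    ∏ x, (Nat.card {i // f x i = l x} : ℚ)

theorem nsmul_single_injective (a : σ) :
    Function.Injective fun n : ℕ => n • Finsupp.single a (1 : ℕ) := fun m n h => by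
  simpa using DFunLike.congr_fun h a

/-- The generating function of the powers of a variable. -/
theorem genFun_nat (a : σ) :
    genFun (fun n : ℕ => n • Finsupp.single a (1 : ℕ)) = (1 - MvPowerSeries.X a)⁻¹ := by
  have hinj := finiteFibers_of_injective (nsmul_single_injective a)
  -- raising the exponent by one multiplies the series by the variable
  have hshift : genFun (fun n : ℕ => (n + 1) • Finsupp.single a (1 : ℕ)) =
      MvPowerSeries.X a * genFun (fun n : ℕ => n • Finsupp.single a (1 : ℕ)) := by
    have h := genFun_prod (finiteFibers_of_finite fun _ : Unit => Finsupp.single a (1 : ℕ)) hinj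
    rw [genFun_fintype (fun _ : Unit => Finsupp.single a (1 : ℕ)), Fintype.sum_unique] at h
    rw [MvPowerSeries.X, ← h, ← genFun_comp_equiv (Equiv.punitProd ℕ).symm]
    congr 1
    ext1 n
    simp only [Function.comp_apply, Equiv.punitProd_symm_apply, add_comm n 1, add_smul, one_smul]
  -- an exponent is zero or a successor
  have hsplit : genFun (fun n : ℕ => n • Finsupp.single a (1 : ℕ)) =
      MvPowerSeries.X a * genFun (fun n : ℕ => n • Finsupp.single a (1 : ℕ)) + 1 := by
    have h := genFun_sum (hinj.comp_injective (Nat.succ_injective))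
      (finiteFibers_of_finite fun _ : PUnit.{1} => (0 : σ →₀ ℕ))
    rw [genFun_fintype (fun _ : PUnit.{1} => (0 : σ →₀ ℕ)), Fintype.sum_unique] at h
    nth_rewrite 1 [← genFun_comp_equiv Equiv.natSumPUnitEquivNat]
    rw [← hshift, ← MvPowerSeries.monomial_zero_one]
    refine Eq.trans ?_ h
    congr 1
    ext1 (n | n)
    · rfl
    · exact zero_smul _ _
  rw [MvPowerSeries.eq_inv_iff_mul_eq_one (by simp), mul_sub, mul_one, sub_eq_iff_eq_add', mul_comm]
  exact hsplit

theorem genFun_fin_two (a : σ) :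
    genFun (fun n : Fin 2 => (n : ℕ) • Finsupp.single a (1 : ℕ)) = 1 + MvPowerSeries.X a := by
  rw [genFun_fintype, Fin.sum_univ_two]
  simp [MvPowerSeries.X]

end GenFun

/-! ### The Hilbert series -/

section Hilbert

variable {Y Z : Type*} [DecidableEq Y] [LinearOrder Z]

variable (Y Z) in
/-- The admissible multisets are the empty one and the `NonzeroMonomial`s. -/
theorem bijective_sumElim_zero :
    Function.Bijective (Sum.elim (fun _ : Unit => ⟨0, admissible_zero⟩)
      (fun m => ⟨m.1, m.2.1⟩) : Unit ⊕ NonzeroMonomial Y Z → {m // Admissible m}) := by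
  constructor
  · rintro (⟨⟩ | ⟨m, hm⟩) (⟨⟩ | ⟨m', hm'⟩) h
    · rfl
    · exact absurd (congrArg Subtype.val h).symm hm'.2
    · exact absurd (congrArg Subtype.val h) hm.2
    · obtain rfl := congrArg Subtype.val h
      rfl
  · rintro ⟨m, hm⟩
    by_cases h0 : m = 0
    · exact ⟨Sum.inl (), Subtype.ext h0.symm⟩
    · exact ⟨Sum.inr ⟨m, hm, h0⟩, rfl⟩

theorem weight_add {X M : Type*} [AddCommMonoid M] (w : X → M) (m n : Multiset X) :
    weight w (m + n) = weight w m + weight w n := by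
  rw [weight, Multiset.map_add, Multiset.sum_add]
  rfl

variable [Fintype Y] [Fintype Z]

variable (Y Z) in
/-- An admissible multiset is given by its multiplicities. -/
def multiplicitiesEquiv :
    ((Y → ℕ) × (Z → Fin 2)) ≃ {m : Multiset (Y ⊕ Z) // Admissible m} where
  toFun n := ⟨∑ y, n.1 y • {Sum.inl y} + ∑ z, (n.2 z : ℕ) • {Sum.inr z}, fun z => by
    simpa [Multiset.count_sum', Multiset.count_singleton] using Nat.le_of_lt_succ (n.2 z).2⟩
  invFun m := (fun y => m.1.count (Sum.inl y),
    fun z => ⟨m.1.count (Sum.inr z), Nat.lt_succ_of_le (m.2 z)⟩)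
  left_inv n := by
    ext x <;> simp [Multiset.count_sum', Multiset.count_singleton]
  right_inv m := by
    refine Subtype.ext (Multiset.ext.2 ?_)
    rintro (y | z) <;> simp [Multiset.count_sum', Multiset.count_singleton]

theorem weight_multiplicitiesEquiv {M : Type*} [AddCommMonoid M] (w : Y ⊕ Z → M)
    (n : (Y → ℕ) × (Z → Fin 2)) :
    weight w (multiplicitiesEquiv Y Z n).1 =
      ∑ y, n.1 y • w (Sum.inl y) + ∑ z, (n.2 z : ℕ) • w (Sum.inr z) := by
  let W : Multiset (Y ⊕ Z) →+ M :=
    { toFun := weight w, map_zero' := rfl, map_add' := weight_add w }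
  have hW : ∀ x, W {x} = w x := fun x => by
    change (Multiset.map w {x}).sum = w x
    rw [Multiset.map_singleton, Multiset.sum_singleton]
  change W (∑ y, n.1 y • {Sum.inl y} + ∑ z, (n.2 z : ℕ) • {Sum.inr z}) = _
  simp only [map_add, map_sum, map_nsmul, hW]

variable {σ : Type*} (f : Y ⊕ Z → σ)

theorem finiteFibers_admissible : FiniteFibers fun m : {m : Multiset (Y ⊕ Z) // Admissible m} =>
    weight (fun x => Finsupp.single (f x) (1 : ℕ)) m.1 := by
  have h := (FiniteFibers.prod
    (FiniteFibers.pi fun y : Y => finiteFibers_of_injective (nsmul_single_injective (f (Sum.inl y))))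
    (FiniteFibers.pi fun z : Z => finiteFibers_of_finite
      fun n : Fin 2 => (n : ℕ) • Finsupp.single (f (Sum.inr z)) (1 : ℕ))).comp_injective
        (multiplicitiesEquiv Y Z).symm.injective
  convert h using 1
  ext1 m
  obtain ⟨n, rfl⟩ := (multiplicitiesEquiv Y Z).surjective m
  rw [weight_multiplicitiesEquiv, Function.comp_apply, Equiv.symm_apply_apply]

theorem genFun_admissible : genFun (fun m : {m : Multiset (Y ⊕ Z) // Admissible m} =>
      weight (fun x => Finsupp.single (f x) (1 : ℕ)) m.1) =
    (∏ y, (1 - MvPowerSeries.X (f (Sum.inl y)))⁻¹) * ∏ z, (1 + MvPowerSeries.X (f (Sum.inr z))) := by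
  have hY := fun y : Y => finiteFibers_of_injective (nsmul_single_injective (f (Sum.inl y)))
  have hZ := fun z : Z => finiteFibers_of_finite
      fun n : Fin 2 => (n : ℕ) • Finsupp.single (f (Sum.inr z)) (1 : ℕ)
  simp only [← genFun_nat, ← genFun_fin_two]
  rw [← genFun_pi hY, ← genFun_pi hZ, ← genFun_prod (FiniteFibers.pi hY) (FiniteFibers.pi hZ),
    ← genFun_comp_equiv (multiplicitiesEquiv Y Z)]
  congr 1
  ext1 n
  exact weight_multiplicitiesEquiv _ n

theorem finiteFibers_nonzeroMonomial : FiniteFibers fun m : NonzeroMonomial Y Z =>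
    weight (fun x => Finsupp.single (f x) (1 : ℕ)) m.1 :=
  (finiteFibers_admissible f).comp_injective
    (e := fun m : NonzeroMonomial Y Z => (⟨m.1, m.2.1⟩ : {m : Multiset (Y ⊕ Z) // Admissible m}))
    fun _ _ h => Subtype.ext (congrArg (fun m : {m : Multiset (Y ⊕ Z) // Admissible m} => m.1) h)

theorem genFun_nonzeroMonomial : genFun (fun m : NonzeroMonomial Y Z =>
      weight (fun x => Finsupp.single (f x) (1 : ℕ)) m.1) =
    (∏ y, (1 - MvPowerSeries.X (f (Sum.inl y)))⁻¹) * (∏ z, (1 + MvPowerSeries.X (f (Sum.inr z))))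
      - 1 := by
  have h := genFun_sum (finiteFibers_of_finite fun _ : Unit => (0 : σ →₀ ℕ))
    (finiteFibers_nonzeroMonomial f)
  rw [genFun_fintype (fun _ : Unit => (0 : σ →₀ ℕ)), Fintype.sum_unique,
    MvPowerSeries.monomial_zero_one] at h
  rw [← genFun_admissible, eq_sub_iff_add_eq', ← h,
    ← genFun_comp_equiv (Equiv.ofBijective _ (bijective_sumElim_zero Y Z))]
  congr 1
  ext1 (_ | m) <;> rfl

theorem genFun_basisIndex : genFun (indexWeight fun x : Y ⊕ Z => Finsupp.single (f x) (1 : ℕ)) =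
    ∑ y, MvPowerSeries.X (f (Sum.inl y)) + ∑ z, MvPowerSeries.X (f (Sum.inr z)) +
      ((∏ y, (1 - MvPowerSeries.X (f (Sum.inl y)))⁻¹) *
        (∏ z, (1 + MvPowerSeries.X (f (Sum.inr z)))) - 1) ^ 2 := by
  have h := finiteFibers_nonzeroMonomial f
  rw [indexWeight, genFun_sum (finiteFibers_of_finite _) (h.prod h), genFun_prod h h,
    genFun_nonzeroMonomial, genFun_fintype, Fintype.sum_sum_type, sq]
  rfl

/-- The series of the dimensions of the components, for the grading in which the generator `x` has
the degree of the variable `f x`. -/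
noncomputable def hilbertSeries (K : Type*) [Field K] {Y Z σ : Type*} (f : Y ⊕ Z → σ) :
    MvPowerSeries σ ℚ := fun d =>
  (Module.finrank K (component K (fun x : Y ⊕ Z => Finsupp.single (f x) (1 : ℕ)) d) : ℚ)

/-- The Hilbert series for a grading that assigns a variable to each generator. -/
theorem hilbertSeries_eq {K : Type*} [Field K] (hK : ringChar K ≠ 2) :
    hilbertSeries K f =
    ∑ y, MvPowerSeries.X (f (Sum.inl y)) + ∑ z, MvPowerSeries.X (f (Sum.inr z)) +
      ((∏ y, (1 - MvPowerSeries.X (f (Sum.inl y)))⁻¹) *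
        (∏ z, (1 + MvPowerSeries.X (f (Sum.inr z)))) - 1) ^ 2 := by
  rw [← genFun_basisIndex f]
  funext d
  exact congrArg Nat.cast (finrank_component hK _ d)

theorem inv_pow_eq_pow_inv {σ : Type*} (F : MvPowerSeries σ ℚ) (n : ℕ) : F⁻¹ ^ n = (F ^ n)⁻¹ := by
  induction n with
  | zero => simp
  | succ n ih => rw [pow_succ, ih, pow_succ', MvPowerSeries.mul_inv_rev]

/-- The total degree can be read as the exponent of a single variable. -/
theorem component_one_eq (K : Type*) [Field K] (Y Z : Type*) (n : ℕ) :
    component K (fun _ : Y ⊕ Z => (1 : ℕ)) n =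
      component K (fun _ : Y ⊕ Z => Finsupp.single () (1 : ℕ)) (Finsupp.single () n) := by
  have h : ∀ t : FreeMagma (Y ⊕ Z), wt (fun _ => Finsupp.single () (1 : ℕ)) t =
      Finsupp.single () (wt (fun _ => (1 : ℕ)) t) := by
    intro t
    induction t with
    | ih1 x => rfl
    | ih2 s t hs ht => rw [wt_mul, wt_mul, hs, ht, Finsupp.single_add]
  simp only [component, absComponent, h, (Finsupp.single_injective ()).eq_iff]

end Hilbert

end BicommSuper

theorem theorem3p2 (K : Type*) [Field K] (hK : ringChar K ≠ 2) (p q : ℕ) :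
    BicommSuper.multigradedHilbertSeries K p q =
        ∑ i : Fin p, MvPowerSeries.X (Sum.inl i) + ∑ j : Fin q, MvPowerSeries.X (Sum.inr j) +
          ((∏ i : Fin p, (1 - MvPowerSeries.X (Sum.inl i))⁻¹) *
            (∏ j : Fin q, (1 + MvPowerSeries.X (Sum.inr j))) - 1) ^ 2 ∧
      BicommSuper.bigradedHilbertSeries K p q =
        (p : MvPowerSeries (Fin 2) ℚ) * MvPowerSeries.X 0 +
          (q : MvPowerSeries (Fin 2) ℚ) * MvPowerSeries.X 1 +
          ((1 + MvPowerSeries.X 1) ^ q * ((1 - MvPowerSeries.X 0) ^ p)⁻¹ - 1) ^ 2 ∧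
      BicommSuper.gradedHilbertSeries K p q =
        ((p : PowerSeries ℚ) + (q : PowerSeries ℚ)) * PowerSeries.X +
          ((1 + PowerSeries.X) ^ q * ((1 - PowerSeries.X) ^ p)⁻¹ - 1) ^ 2 := by
  refine ⟨BicommSuper.hilbertSeries_eq id hK, ?_, ?_⟩
  · have h := BicommSuper.hilbertSeries_eq
      (Sum.elim (fun _ => 0) (fun _ => 1) : Fin p ⊕ Fin q → Fin 2) hK
    have hw : (fun x : Fin p ⊕ Fin q => Finsupp.single
        ((Sum.elim (fun _ => 0) (fun _ => 1) : Fin p ⊕ Fin q → Fin 2) x) (1 : ℕ)) =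
        BicommSuper.biWeight p q := by
      funext x
      rcases x with x | x <;> rfl
    have hs : BicommSuper.hilbertSeries K (Sum.elim (fun _ => 0) (fun _ => 1) :
        Fin p ⊕ Fin q → Fin 2) = BicommSuper.bigradedHilbertSeries K p q := by
      funext d
      exact congrArg (fun w => (Module.finrank K (BicommSuper.component K w d) : ℚ)) hw
    rw [hs] at h
    simp only [Sum.elim_inl, Sum.elim_inr, Finset.sum_const, Finset.prod_const, Finset.card_univ,
      Fintype.card_fin, nsmul_eq_mul, BicommSuper.inv_pow_eq_pow_inv] at h
    rw [mul_comm ((1 + _) ^ q)]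
    exact h
  · have h := BicommSuper.hilbertSeries_eq (fun _ : Fin p ⊕ Fin q => ()) hK
    simp only [Finset.sum_const, Finset.prod_const, Finset.card_univ, Fintype.card_fin,
      nsmul_eq_mul, BicommSuper.inv_pow_eq_pow_inv] at h
    rw [mul_comm ((1 + _) ^ q), add_mul]
    refine Eq.trans ?_ h
    ext n
    rw [BicommSuper.gradedHilbertSeries, PowerSeries.coeff_mk, BicommSuper.component_one_eq]
    rfl
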